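/- Let $\{(S_1(t),S_2(t))\}_{t\ge 0}$ and $\{(T_1(t),T_2(t))\}_{t\ge 0}$ be bivariate subordinators without drift on a common probability space, i.e. Lévy processes in $\mathbb{R}^2$ whose coordinates are almost surely non-decreasing, with Lévy measures $\nu$ and $\mu$ respectively. Here a Lévy measure is a measure $\nu$ on $[0,\infty)^2\setminus\{(0,0)\}$ with $\iint\min\{1,\sqrt{x_1^2+x_2^2}\}\,\nu(\mathrm{d}x_1,\mathrm{d}x_2)<\infty$, and that $\nu$ is the Lévy measure of $(S_1,S_2)$ means $\mathbb{E}e^{-\eta_1S_1(1)-\eta_2S_2(1)}=e^{-B^{\nu}(\eta_1,\eta_2)}$ for $\eta_1,\eta_2>0$, where $$B^{\nu}(\eta_1,\eta_2)=\iint_{[0,\infty)^2}\bigl(1-e^{-\eta_1x_1-\eta_2x_2}\bigr)\,\nu(\mathrm{d}x_1,\mathrm{d}x_2).$$ Put also $B^{\nu}_i(\eta)=\int_{(0,\infty)}(1-e^{-\eta x})\,\nu_i(\mathrm{d}x)$, where $\nu_1(A)=\nu(A\times[0,\infty))$ and $\nu_2(A)=\nu([0,\infty)\times A)$ for Borel $A\subseteq(0,\infty)$;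 define $B^{\mu}$, $B^{\mu}_i$, $\mu_i$ in the same way. Assume that $\mu_1\neq0$ and $\mu_2\neq0$, let $$L_i(t)=\inf\{u>0:\ T_i(u)>t\},\qquad t\ge0,\ i=1,2,$$ be the (almost surely finite) inverses of $T_1,T_2$, and assume that $\{(L_1(t_1),L_2(t_2))\}_{t_1,t_2\ge0}$ is independent of $\{(S_1(t),S_2(t))\}_{t\ge0}$. Let $H_i(t)=S_i(L_i(t))$, $i=1,2$. Then for all $z_1,z_2,\eta_1,\eta_2>0$ the expectations and integrals below exist as integrals of integrable functions, and $$\int_0^\infty\!\!\int_0^\infty e^{-z_1t_1-z_2t_2}\,\mathbb{E}e^{-\eta_1H_1(t_1)-\eta_2H_2(t_2)}\,\mathrm{d}t_2\,\mathrm{d}t_1=\frac{1}{z_1z_2\bigl(B^{\nu}(\eta_1,\eta_2)+B^{\mu}(z_1,z_2)\bigr)}\left(\frac{B^{\mu}_2(z_2)\bigl(B^{\mu}(z_1,z_2)-B^{\mu}_2(z_2)\bigr)}{B^{\nu}_2(\eta_2)+B^{\mu}_2(z_2)}+\frac{B^{\mu}_1(z_1)\bigl(B^{\mu}(z_1,z_2)-B^{\mu}_1(z_1)\bigr)}{B^{\nu}_1(\eta_1)+B^{\mu}_1(z_1)}+B^{\mu}_1(z_1)+B^{\mu}_2(z_2)-B^{\mu}(z_1,z_2)\right).$$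 (When $\mu=\nu$ all the functions are the same $B$, $B_1$, $B_2$.) -/

import Mathlib

open MeasureTheory ProbabilityTheory Set Filter Topology
open scoped NNReal ENNReal

/-- The measure `ν` on the plane is a Lévy measure of a bivariate subordinator: it lives on
`[0,∞)² \ {(0,0)}` and integrates `min {1, √(x₁² + x₂²)}`. -/
structure IsBivariateLevyMeasure (ν : Measure (ℝ × ℝ)) : Prop where
  zero : ν {(0, 0)} = 0
  support : ν (Ici (0 : ℝ) ×ˢ Ici (0 : ℝ))ᶜ = 0
  lintegral_lt_top :
    ∫⁻ x : ℝ × ℝ, ENNReal.ofReal (min 1 (Real.sqrt (x.1 ^ 2 + x.2 ^ 2))) ∂ν < ∞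

/-- The Lévy measure `ν₁` on `(0,∞)` of the first coordinate: `ν₁ A = ν (A × [0,∞))`. -/
noncomputable def marginalLevy₁ (ν : Measure (ℝ × ℝ)) : Measure ℝ :=
  (ν.map Prod.fst).restrict (Ioi 0)

/-- The Lévy measure `ν₂` on `(0,∞)` of the second coordinate: `ν₂ A = ν ([0,∞) × A)`. -/
noncomputable def marginalLevy₂ (ν : Measure (ℝ × ℝ)) : Measure ℝ :=
  (ν.map Prod.snd).restrict (Ioi 0)

/-- The Bernstein function `η ↦ ∫_{(0,∞)} (1 - e^{-η x}) ρ(dx)` of a measure `ρ`. -/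
noncomputable def bernsteinUni (ρ : Measure ℝ) (η : ℝ) : ℝ :=
  ∫ x in Ioi (0 : ℝ), (1 - Real.exp (-η * x)) ∂ρ

/-- The bivariate Bernstein function
`(η₁, η₂) ↦ ∫∫_{[0,∞)²} (1 - e^{-η₁ x₁ - η₂ x₂}) ν(dx₁, dx₂)`. -/
noncomputable def bernsteinBiv (ν : Measure (ℝ × ℝ)) (η₁ η₂ : ℝ) : ℝ :=
  ∫ x in Ici (0 : ℝ) ×ˢ Ici (0 : ℝ), (1 - Real.exp (-η₁ * x.1 - η₂ * x.2)) ∂ν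

/-- A Lévy process in the plane: it starts at `0`, has independent and stationary increments, is
stochastically continuous and has càdlàg paths almost surely. -/
structure IsLevyProcess {Ω : Type*} [MeasurableSpace Ω] (X : ℝ≥0 → Ω → ℝ × ℝ)
    (P : Measure Ω) : Prop where
  measurable : ∀ t, Measurable (X t)
  start : ∀ᵐ ω ∂P, X 0 ω = 0
  indep : HasIndepIncrements X P
  stationary : ∀ s t : ℝ≥0, IdentDistrib (fun ω => X (s + t) ω - X s ω) (X t) P P
  stochCont : ∀ t : ℝ≥0, TendstoInMeasure P X (𝓝 t) (X t)
  cadlag : ∀ᵐ ω ∂P, ∀ t : ℝ≥0,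
    ContinuousWithinAt (fun u => X u ω) (Ici t) t ∧
      ∃ l : ℝ × ℝ, Tendsto (fun u => X u ω) (𝓝[<] t) (𝓝 l)

/-- `X = (X₁, X₂)` is a bivariate subordinator (without drift) with Lévy measure `ν`: a Lévy
process with almost surely non-decreasing coordinates, such that the Laplace exponent of `X 1` is
the bivariate Bernstein function of `ν`. -/
structure IsBivariateSubordinator {Ω : Type*} [MeasurableSpace Ω] (X : ℝ≥0 → Ω → ℝ × ℝ)
    (ν : Measure (ℝ × ℝ)) (P : Measure Ω) : Prop where
  levy : IsLevyProcess X P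
  mono : ∀ᵐ ω ∂P, Monotone (fun u => (X u ω).1) ∧ Monotone (fun u => (X u ω).2)
  levyMeasure : IsBivariateLevyMeasure ν
  laplace : ∀ η₁ η₂ : ℝ, 0 < η₁ → 0 < η₂ →
    ∫ ω, Real.exp (-η₁ * (X 1 ω).1 - η₂ * (X 1 ω).2) ∂P = Real.exp (-bernsteinBiv ν η₁ η₂)

/-- The right-continuous inverse `t ↦ inf {u > 0 : Y u > t}` of a real-valued process `Y`. -/
noncomputable def rightInverse {Ω : Type*} (Y : ℝ≥0 → Ω → ℝ) (t : ℝ) (ω : Ω) : ℝ≥0 :=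
  sInf {u : ℝ≥0 | 0 < u ∧ t < Y u ω}

/-- `L₁ t = inf {u > 0 : T₁ u > t}` for a bivariate process `T = (T₁, T₂)`. -/
noncomputable def inverse₁ {Ω : Type*} (T : ℝ≥0 → Ω → ℝ × ℝ) (t : ℝ) (ω : Ω) : ℝ≥0 :=
  rightInverse (fun u ω => (T u ω).1) t ω

/-- `L₂ t = inf {u > 0 : T₂ u > t}` for a bivariate process `T = (T₁, T₂)`. -/
noncomputable def inverse₂ {Ω : Type*} (T : ℝ≥0 → Ω → ℝ × ℝ) (t : ℝ) (ω : Ω) : ℝ≥0 :=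
  rightInverse (fun u ω => (T u ω).2) t ω

/-- `H₁ t = S₁ (L₁ t)`, where `L` is the inverse of `T`. -/
noncomputable def composition₁ {Ω : Type*} (S T : ℝ≥0 → Ω → ℝ × ℝ) (t : ℝ) (ω : Ω) : ℝ :=
  (S (inverse₁ T t ω) ω).1

/-- `H₂ t = S₂ (L₂ t)`, where `L` is the inverse of `T`. -/
noncomputable def composition₂ {Ω : Type*} (S T : ℝ≥0 → Ω → ℝ × ℝ) (t : ℝ) (ω : Ω) : ℝ :=
  (S (inverse₂ T t ω) ω).2

/-! After multiplication by `z₁ z₂`, the double integral is an expectation at independent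
exponential times `e₁`, `e₂` with rates `z₁`, `z₂`. Two dual facts then determine it.

For a bivariate subordinator with exponent `B`, independent increments give `E exp(-a X₁(u) - b
X₂(v)) = exp(-p u - q v - r max(u, v))` with `p = B(a,b) - B(0,b)`, `q = B(a,b) - B(a,0)`, `r =
B(a,0) + B(0,b) - B(a,b)`, all nonnegative (`integral_exp_two_times`). This is a Marshall–Olkin
survival function.

Applied to `T`: up to null sets `L_i(e_i) > u` means `T_i(u) < e_i`, so `P(L₁(e₁) > u, L₂(e₂) > v) =
E exp(-z₁ T₁(u) - z₂ T₂(v))`, and `(L₁(e₁), L₂(e₂))` has a Marshall–Olkin law (`map_inversePair`).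
Applied to `S`, which is independent of the inverses: conditioning on `(L₁, L₂)` turns the
exponential of `H` into another Marshall–Olkin survival function, evaluated at `(L₁, L₂)`
(`integral_exp_random_times`).

What remains is the integral of one such function against one such law (`integral_marshallOlkin`).
The law is a mixture: the minimum is exponential of rate `p + q + r`; with weights proportional to
`p`, `q`, `r` it is attained by the first coordinate, by the second, or by both, and a surviving
coordinate lives for a further independent exponential time. -/

/-! ### Exponential laws -/

theorem integral_expMeasure {r : ℝ} (hr : 0 < r) (f : ℝ → ℝ) :
    ∫ x, f x ∂(expMeasure r) = ∫ x in Ioi (0 : ℝ), r * Real.exp (-(r * x)) * f x := by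
  have h : expMeasure r = volume.withDensity (exponentialPDF r) := rfl
  have hm : Measurable (exponentialPDF r) :=
    (measurable_exponentialPDFReal r).ennreal_ofReal
  rw [h, integral_withDensity_eq_integral_toReal_smul hm (by simp [exponentialPDF]),
    ← integral_Ici_eq_integral_Ioi, ← integral_indicator measurableSet_Ici]
  congr 1 with x
  by_cases hx : 0 ≤ x
  · rw [indicator_of_mem (mem_Ici.2 hx), exponentialPDF_of_nonneg hx,
      ENNReal.toReal_ofReal (by positivity), smul_eq_mul]
  · rw [indicator_of_notMem (by simpa using hx), exponentialPDF_of_neg (not_le.1 hx)]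
    simp

instance expMeasure_nullSingletonClass (r : ℝ) : NullSingletonClass (expMeasure r) := by
  have h : expMeasure r = volume.withDensity (exponentialPDF r) := rfl
  rw [h]; infer_instance

theorem expMeasure_Ioi_of_nonneg {r : ℝ} (hr : 0 < r) {x : ℝ} (hx : 0 ≤ x) :
    expMeasure r (Ioi x) = ENNReal.ofReal (Real.exp (-(r * x))) := by
  have := isProbabilityMeasure_expMeasure hr
  have h := cdf_expMeasure_eq hr x
  rw [if_pos hx, cdf_eq_real] at h
  have h2 : (expMeasure r).real (Ioi x) = Real.exp (-(r * x)) := by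
    rw [← compl_Iic, probReal_compl_eq_one_sub measurableSet_Iic, h]; ring
  rw [← h2, ofReal_measureReal]

theorem expMeasure_Ioi {r : ℝ} (hr : 0 < r) (x : ℝ) :
    expMeasure r (Ioi x) = ENNReal.ofReal (Real.exp (-(r * max x 0))) := by
  rcases le_total 0 x with hx | hx
  · rw [max_eq_left hx, expMeasure_Ioi_of_nonneg hr hx]
  · have := isProbabilityMeasure_expMeasure hr
    rw [max_eq_right hx]
    refine le_antisymm ?_ ?_
    · simpa using prob_le_one
    · rw [← expMeasure_Ioi_of_nonneg hr le_rfl]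
      exact measure_mono (Ioi_subset_Ioi hx)

theorem ae_pos_expMeasure {r : ℝ} (hr : 0 < r) : ∀ᵐ x ∂(expMeasure r), 0 < x := by
  have := isProbabilityMeasure_expMeasure hr
  have h : expMeasure r (Ioi 0) = 1 := by simp [expMeasure_Ioi hr]
  exact (prob_compl_eq_zero_iff measurableSet_Ioi).2 h

theorem integral_exp_expMeasure {r s : ℝ} (hr : 0 < r) (hs : 0 ≤ s) :
    ∫ x, Real.exp (-s * x) ∂(expMeasure r) = r / (r + s) := by
  rw [integral_expMeasure hr]
  have h : ∀ x : ℝ, r * Real.exp (-(r * x)) * Real.exp (-s * x) =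
      r * Real.exp (-(r + s) * x) := by
    intro x; rw [mul_assoc, ← Real.exp_add]; ring_nf
  simp_rw [h]
  rw [integral_const_mul, integral_exp_mul_Ioi (by linarith)]
  have : r + s ≠ 0 := by positivity
  field_simp
  simp

/-! ### The Marshall–Olkin law -/

/-- The Marshall–Olkin law: the bivariate exponential law with survival function
`exp (-p u - q v - r max u v)`. -/
noncomputable def marshallOlkin (p q r : ℝ) : Measure (ℝ × ℝ) :=
  ENNReal.ofReal (p / (p + q + r)) •
      ((expMeasure (p + q + r)).prod (expMeasure (q + r))).map (fun x => (x.1, x.1 + x.2)) +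
    ENNReal.ofReal (q / (p + q + r)) •
      ((expMeasure (p + q + r)).prod (expMeasure (p + r))).map (fun x => (x.1 + x.2, x.1)) +
    ENNReal.ofReal (r / (p + q + r)) • (expMeasure (p + q + r)).map (fun x => (x, x))

/-- Quadrants with arbitrary real corners form a generating π-system. Both measures are carried by
the open positive quadrant (for `N` this is `h` at the origin), so a corner may be replaced by its
positive part. -/
theorem Measure.ext_of_Ioi_prod_Ioi {M N : Measure (ℝ × ℝ)} [IsProbabilityMeasure M]
    [IsProbabilityMeasure N] (h₁ : M (Ioi 0 ×ˢ Ioi 0) = 1)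
    (h : ∀ u v : ℝ, 0 ≤ u → 0 ≤ v → M (Ioi u ×ˢ Ioi v) = N (Ioi u ×ˢ Ioi v)) : M = N := by
  have key : ∀ (K : Measure (ℝ × ℝ)) [IsProbabilityMeasure K], K (Ioi 0 ×ˢ Ioi 0) = 1 →
      ∀ u v : ℝ, K (Ioi u ×ˢ Ioi v) = K (Ioi (max u 0) ×ˢ Ioi (max v 0)) := by
    intro K _ hK u v
    have hae : ∀ᵐ x ∂K, x ∈ Ioi (0 : ℝ) ×ˢ Ioi (0 : ℝ) :=
      (prob_compl_eq_zero_iff (measurableSet_Ioi.prod measurableSet_Ioi)).2 hK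
    refine measure_congr ?_
    filter_upwards [hae] with x hx
    obtain ⟨h1, h2⟩ := hx
    apply propext
    change (u < x.1 ∧ v < x.2) ↔ (max u 0 < x.1 ∧ max v 0 < x.2)
    simp only [mem_Ioi] at h1 h2
    simp [h1, h2]
  have hN : N (Ioi 0 ×ˢ Ioi 0) = 1 := by rw [← h 0 0 le_rfl le_rfl, h₁]
  have hpi : IsPiSystem (range (Ioi : ℝ → Set ℝ)) := isPiSystem_Ioi
  have hsp : IsCountablySpanning (range (Ioi : ℝ → Set ℝ)) := by
    refine ⟨fun n : ℕ => Ioi (-(n : ℝ)), fun n => mem_range_self _, ?_⟩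
    refine eq_univ_of_forall fun x => mem_iUnion.2 ?_
    obtain ⟨n, hn⟩ := exists_nat_gt (-x)
    exact ⟨n, by simp only [mem_Ioi]; linarith⟩
  refine ext_of_generate_finite (image2 (· ×ˢ ·) (range (Ioi : ℝ → Set ℝ)) (range Ioi))
    ?_ (hpi.prod hpi) ?_ (by simp)
  · have hb : (inferInstance : MeasurableSpace ℝ) = MeasurableSpace.generateFrom (range Ioi) := by
      rw [← borel_eq_generateFrom_Ioi]; exact BorelSpace.measurable_eq
    exact (generateFrom_eq_prod hb.symm hb.symm hsp hsp).symm
  · rintro _ ⟨_, ⟨u, rfl⟩, _, ⟨v, rfl⟩, rfl⟩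
    change M (Ioi u ×ˢ Ioi v) = N (Ioi u ×ˢ Ioi v)
    rw [key M h₁, key N hN, h _ _ (le_max_right _ _) (le_max_right _ _)]

theorem prod_expMeasure_quadrant_eq_integral {l b : ℝ} (hl : 0 < l) (hb : 0 < b) (u v : ℝ)
    (hu : 0 ≤ u) :
    ((expMeasure l).prod (expMeasure b)) {x | u < x.1 ∧ v < x.1 + x.2} =
      ENNReal.ofReal
        (∫ x in Ioi u, l * Real.exp (-(l * x)) * Real.exp (-(b * max (v - x) 0))) := by
  have := isProbabilityMeasure_expMeasure hl
  have := isProbabilityMeasure_expMeasure hb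
  have hS : MeasurableSet {x : ℝ × ℝ | u < x.1 ∧ v < x.1 + x.2} :=
    (measurableSet_lt measurable_const measurable_fst).inter
      (measurableSet_lt measurable_const (measurable_fst.add measurable_snd))
  have hf : Measurable fun x : ℝ => Real.exp (-(b * max (v - x) 0)) := by fun_prop
  have hint : Integrable ((Ioi u).indicator fun x : ℝ => Real.exp (-(b * max (v - x) 0)))
      (expMeasure l) := by
    refine Integrable.of_bound ((hf.indicator measurableSet_Ioi).aestronglyMeasurable) 1 ?_
    refine Eventually.of_forall fun x => ?_
    by_cases hx : x ∈ Ioi u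
    · rw [indicator_of_mem hx, Real.norm_of_nonneg (Real.exp_pos _).le, Real.exp_le_one_iff]
      have : 0 ≤ b * max (v - x) 0 := by positivity
      linarith
    · rw [indicator_of_notMem hx]; simp
  have h1 : ∫ x in Ioi u, l * Real.exp (-(l * x)) * Real.exp (-(b * max (v - x) 0)) =
      ∫ x, (Ioi u).indicator (fun x : ℝ => Real.exp (-(b * max (v - x) 0))) x
        ∂(expMeasure l) := by
    rw [integral_expMeasure hl, ← integral_indicator measurableSet_Ioi,
      ← integral_indicator measurableSet_Ioi]
    congr 1 with x
    by_cases hx : u < x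
    · simp [indicator, hx, hu.trans_lt hx]
    · simp [indicator, hx]
  rw [h1, ofReal_integral_eq_lintegral_ofReal hint, Measure.prod_apply hS]
  · refine lintegral_congr fun x => ?_
    by_cases hx : u < x
    · have : Prod.mk x ⁻¹' {x : ℝ × ℝ | u < x.1 ∧ v < x.1 + x.2} = Ioi (v - x) := by
        ext y; simp [hx, sub_lt_iff_lt_add']
      rw [this, expMeasure_Ioi hb, indicator_of_mem (mem_Ioi.2 hx)]
    · have : Prod.mk x ⁻¹' {x : ℝ × ℝ | u < x.1 ∧ v < x.1 + x.2} = ∅ := by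
        ext y; simp [hx]
      rw [this, indicator_of_notMem (by simpa using hx)]
      simp
  · exact Eventually.of_forall fun x => indicator_nonneg (fun _ _ => (Real.exp_pos _).le) x

theorem integral_Ioi_exp_of_le {l b : ℝ} (hl : 0 < l) {u v : ℝ} (h : v ≤ u) :
    ∫ x in Ioi u, l * Real.exp (-(l * x)) * Real.exp (-(b * max (v - x) 0)) =
      Real.exp (-(l * u)) := by
  have h1 : ∫ x in Ioi u, l * Real.exp (-(l * x)) * Real.exp (-(b * max (v - x) 0)) =
      ∫ x in Ioi u, l * Real.exp (-l * x) := by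
    refine setIntegral_congr_fun measurableSet_Ioi fun x hx => ?_
    simp only [mem_Ioi] at hx
    simp [max_eq_right (by linarith : v - x ≤ 0)]
  rw [h1, integral_const_mul, integral_exp_mul_Ioi (by linarith)]
  field_simp

/-- The integral is split at `v`, where the maximum changes branch. The factor `p` on both sides
avoids dividing by `p`, which may be zero. -/
theorem mul_integral_Ioi_exp_of_ge {p b : ℝ} (hl : 0 < p + b) {u v : ℝ}
    (h : u ≤ v) :
    p * ∫ x in Ioi u, (p + b) * Real.exp (-((p + b) * x)) * Real.exp (-(b * max (v - x) 0)) =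
      (p + b) * (Real.exp (-(p * u) - b * v) - Real.exp (-((p + b) * v))) +
        p * Real.exp (-((p + b) * v)) := by
  have hi : IntegrableOn (fun x => (p + b) * Real.exp (-((p + b) * x)) *
      Real.exp (-(b * max (v - x) 0))) (Ioi v) := by
    have : IntegrableOn (fun x => (p + b) * Real.exp (-(p + b) * x)) (Ioi v) :=
      (integrableOn_exp_mul_Ioi (by linarith) v).const_mul _
    refine this.congr_fun (fun x hx => ?_) measurableSet_Ioi
    simp only [mem_Ioi] at hx
    simp only [max_eq_right (by linarith : v - x ≤ 0), mul_zero, neg_zero, Real.exp_zero, mul_one,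
      neg_mul]
  have hi2 : IntegrableOn (fun x => (p + b) * Real.exp (-((p + b) * x)) *
      Real.exp (-(b * max (v - x) 0))) (Ioc u v) := by
    have : Continuous (fun x => (p + b) * Real.exp (-((p + b) * x)) *
      Real.exp (-(b * max (v - x) 0))) := by fun_prop
    exact this.integrableOn_Ioc
  rw [← Ioc_union_Ioi_eq_Ioi h, setIntegral_union (Ioc_disjoint_Ioi le_rfl) measurableSet_Ioi hi2 hi,
    integral_Ioi_exp_of_le hl le_rfl, mul_add, ← intervalIntegral.integral_of_le h]
  congr 1
  have h2 : ∫ x in u..v, (p + b) * Real.exp (-((p + b) * x)) * Real.exp (-(b * max (v - x) 0)) =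
      ∫ x in u..v, (p + b) * Real.exp (-(p * x) - b * v) := by
    refine intervalIntegral.integral_congr fun x hx => ?_
    rw [uIcc_of_le h] at hx
    simp only [max_eq_left (by linarith [hx.2] : 0 ≤ v - x)]
    rw [mul_assoc, ← Real.exp_add]; ring_nf
  rw [h2, ← intervalIntegral.integral_const_mul]
  have hd : ∀ x ∈ uIcc u v, HasDerivAt (fun x => -(p + b) * Real.exp (-(p * x) - b * v))
      (p * ((p + b) * Real.exp (-(p * x) - b * v))) x := by
    intro x _
    have h1 : HasDerivAt (fun x => -(p * x) - b * v) (-p) x := by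
      simpa using (((hasDerivAt_id x).const_mul p).neg).sub_const (b * v)
    exact (h1.exp.const_mul (-(p + b))).congr_deriv (by ring)
  rw [intervalIntegral.integral_eq_sub_of_hasDerivAt hd
    ((by fun_prop : Continuous fun x => p * ((p + b) * Real.exp (-(p * x) - b * v))).intervalIntegrable _ _)]
  have : -(p * v) - b * v = -((p + b) * v) := by ring
  rw [this]; ring

/-- If `u ≤ v`, only the component whose first coordinate is the smaller needs a genuine
convolution; in the other two the event says that the minimum exceeds `v`. The case `v ≤ u` is
symmetric. -/
theorem marshallOlkin_quadrant {p q r : ℝ} (hp : 0 ≤ p) (hq : 0 ≤ q) (hr : 0 ≤ r)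
    (ha : 0 < p + r) (hb : 0 < q + r) {u v : ℝ} (hu : 0 ≤ u) (hv : 0 ≤ v) :
    marshallOlkin p q r (Ioi u ×ˢ Ioi v) =
      ENNReal.ofReal (Real.exp (-(p * u) - q * v - r * max u v)) := by
  have hl : 0 < p + q + r := by linarith
  have := isProbabilityMeasure_expMeasure hl
  have hQ : MeasurableSet (Ioi u ×ˢ Ioi v) := measurableSet_Ioi.prod measurableSet_Ioi
  rw [marshallOlkin, Measure.add_apply, Measure.add_apply, Measure.smul_apply, Measure.smul_apply,
    Measure.smul_apply, Measure.map_apply (by fun_prop) hQ, Measure.map_apply (by fun_prop) hQ,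
    Measure.map_apply (by fun_prop) hQ]
  have e1 : (fun x : ℝ × ℝ => (x.1, x.1 + x.2)) ⁻¹' (Ioi u ×ˢ Ioi v) =
      {x | u < x.1 ∧ v < x.1 + x.2} := rfl
  have e2 : (fun x : ℝ × ℝ => (x.1 + x.2, x.1)) ⁻¹' (Ioi u ×ˢ Ioi v) =
      {x | v < x.1 ∧ u < x.1 + x.2} := by
    ext x; exact and_comm
  have e3 : (fun x : ℝ => (x, x)) ⁻¹' (Ioi u ×ˢ Ioi v) = Ioi (max u v) := by
    ext x; simp
  rw [e1, e2, e3, prod_expMeasure_quadrant_eq_integral hl hb u v hu,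
    prod_expMeasure_quadrant_eq_integral hl ha v u hv, expMeasure_Ioi hl,
    max_eq_left (hu.trans (le_max_left u v)), smul_eq_mul, smul_eq_mul, smul_eq_mul,
    ← ENNReal.ofReal_mul (by positivity), ← ENNReal.ofReal_mul (by positivity),
    ← ENNReal.ofReal_mul (by positivity)]
  have n : ∀ (b u v : ℝ), 0 ≤ ∫ x in Ioi u, (p + q + r) * Real.exp (-((p + q + r) * x)) *
      Real.exp (-(b * max (v - x) 0)) := fun b u v =>
    setIntegral_nonneg measurableSet_Ioi fun x _ => by positivity
  rw [← ENNReal.ofReal_add (mul_nonneg (by positivity) (n _ _ _))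
    (mul_nonneg (by positivity) (n _ _ _)), ← ENNReal.ofReal_add (add_nonneg
    (mul_nonneg (by positivity) (n _ _ _)) (mul_nonneg (by positivity) (n _ _ _)))
    (by positivity)]
  congr 1
  have hl' : p + q + r ≠ 0 := hl.ne'
  rcases le_total u v with h | h
  · have h1 := mul_integral_Ioi_exp_of_ge (p := p) (b := q + r) (by linarith) h
    rw [← add_assoc] at h1
    rw [div_mul_eq_mul_div, h1, integral_Ioi_exp_of_le hl h, max_eq_right h]
    have e : -(p * u) - q * v - r * v = -(p * u) - (q + r) * v := by ring
    rw [e]; field_simp; ring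
  · have h1 := mul_integral_Ioi_exp_of_ge (p := q) (b := p + r) (by linarith) h
    rw [← add_assoc, add_comm q p] at h1
    rw [div_mul_eq_mul_div q, h1, integral_Ioi_exp_of_le hl h, max_eq_left h]
    have e : -(p * u) - q * v - r * u = -(q * v) - (p + r) * u := by ring
    rw [e]; field_simp; ring

theorem isProbabilityMeasure_marshallOlkin {p q r : ℝ} (hp : 0 ≤ p) (hq : 0 ≤ q) (hr : 0 ≤ r)
    (ha : 0 < p + r) (hb : 0 < q + r) : IsProbabilityMeasure (marshallOlkin p q r) := by
  have hl : 0 < p + q + r := by linarith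
  have := isProbabilityMeasure_expMeasure hl
  have := isProbabilityMeasure_expMeasure ha
  have := isProbabilityMeasure_expMeasure hb
  refine ⟨?_⟩
  rw [marshallOlkin, Measure.add_apply, Measure.add_apply, Measure.smul_apply, Measure.smul_apply,
    Measure.smul_apply, Measure.map_apply (by fun_prop) .univ,
    Measure.map_apply (by fun_prop) .univ, Measure.map_apply (by fun_prop) .univ]
  simp only [preimage_univ, measure_univ, smul_eq_mul, mul_one]
  rw [← ENNReal.ofReal_add (by positivity) (by positivity),
    ← ENNReal.ofReal_add (by positivity) (by positivity), ← add_div, ← add_div, div_self hl.ne',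
    ENNReal.ofReal_one]

theorem integral_prod_expMeasure_exp {l b s t : ℝ} (hl : 0 < l) (hb : 0 < b) (hs : 0 ≤ s)
    (ht : 0 ≤ t) :
    ∫ x, Real.exp (-s * x.1 - t * x.2) ∂((expMeasure l).prod (expMeasure b)) =
      l / (l + s) * (b / (b + t)) := by
  have := isProbabilityMeasure_expMeasure hl
  have := isProbabilityMeasure_expMeasure hb
  rw [← integral_exp_expMeasure hl hs, ← integral_exp_expMeasure hb ht, ← integral_prod_mul]
  congr 1 with x
  rw [← Real.exp_add]; ring_nf

/-- On each mixture component the larger coordinate is known, so the integrand becomes a product of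
exponentials of independent variables. -/
theorem integral_marshallOlkin {p q r : ℝ} (hp : 0 ≤ p) (hq : 0 ≤ q) (hr : 0 ≤ r)
    (ha : 0 < p + r) (hb : 0 < q + r) {p' q' r' : ℝ} (hp' : 0 ≤ p') (hq' : 0 ≤ q') (hr' : 0 ≤ r') :
    ∫ x, Real.exp (-(p' * x.1) - q' * x.2 - r' * max x.1 x.2) ∂(marshallOlkin p q r) =
      1 / ((p' + q' + r') + (p + q + r)) * ((q + r) * p / ((q' + r') + (q + r)) +
        (p + r) * q / ((p' + r') + (p + r)) + r) := by
  have hl : 0 < p + q + r := by linarith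
  have := isProbabilityMeasure_expMeasure hl
  have := isProbabilityMeasure_expMeasure ha
  have := isProbabilityMeasure_expMeasure hb
  have hm : Continuous fun x : ℝ × ℝ =>
    Real.exp (-(p' * x.1) - q' * x.2 - r' * max x.1 x.2) := by fun_prop
  have hint : ∀ (K : Measure (ℝ × ℝ)) [IsFiniteMeasure K], (∀ᵐ x ∂K, 0 < x.1 ∧ 0 < x.2) →
      Integrable (fun x : ℝ × ℝ => Real.exp (-(p' * x.1) - q' * x.2 - r' * max x.1 x.2)) K := by
    intro K _ hK
    refine Integrable.of_bound hm.aestronglyMeasurable 1 ?_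
    filter_upwards [hK] with x ⟨h1, h2⟩
    rw [Real.norm_of_nonneg (Real.exp_pos _).le, Real.exp_le_one_iff]
    have : 0 ≤ p' * x.1 + q' * x.2 + r' * max x.1 x.2 := by
      have : 0 ≤ max x.1 x.2 := h1.le.trans (le_max_left _ _)
      positivity
    linarith
  have hpos : ∀ c : ℝ, 0 < c → ∀ᵐ x ∂((expMeasure (p + q + r)).prod (expMeasure c)),
      0 < x.1 ∧ 0 < x.2 := by
    intro c hc
    have := isProbabilityMeasure_expMeasure hc
    exact (Measure.quasiMeasurePreserving_fst.ae (ae_pos_expMeasure hl)).and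
      (Measure.quasiMeasurePreserving_snd.ae (ae_pos_expMeasure hc))
  have i1 := hint (((expMeasure (p + q + r)).prod (expMeasure (q + r))).map
    (fun x => (x.1, x.1 + x.2))) (by
      rw [ae_map_iff (by fun_prop) (by measurability)]
      filter_upwards [hpos _ hb] with x ⟨h1, h2⟩
      exact ⟨h1, add_pos h1 h2⟩)
  have i2 := hint (((expMeasure (p + q + r)).prod (expMeasure (p + r))).map
    (fun x => (x.1 + x.2, x.1))) (by
      rw [ae_map_iff (by fun_prop) (by measurability)]
      filter_upwards [hpos _ ha] with x ⟨h1, h2⟩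
      exact ⟨add_pos h1 h2, h1⟩)
  have i3 := hint ((expMeasure (p + q + r)).map (fun x => (x, x))) (by
      rw [ae_map_iff (by fun_prop) (by measurability)]
      filter_upwards [ae_pos_expMeasure hl] with x h1
      exact ⟨h1, h1⟩)
  have j1 := i1.smul_measure (ENNReal.ofReal_ne_top (r := p / (p + q + r)))
  have j2 := i2.smul_measure (ENNReal.ofReal_ne_top (r := q / (p + q + r)))
  have j3 := i3.smul_measure (ENNReal.ofReal_ne_top (r := r / (p + q + r)))
  rw [marshallOlkin, integral_add_measure (j1.add_measure j2) j3, integral_add_measure j1 j2,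
    integral_smul_measure, integral_smul_measure, integral_smul_measure,
    integral_map (by fun_prop) hm.aestronglyMeasurable,
    integral_map (by fun_prop) hm.aestronglyMeasurable,
    integral_map (by fun_prop) hm.aestronglyMeasurable]
  have e1 : ∫ x, Real.exp (-(p' * x.1) - q' * (x.1 + x.2) - r' * max x.1 (x.1 + x.2))
      ∂((expMeasure (p + q + r)).prod (expMeasure (q + r))) =
      (p + q + r) / ((p + q + r) + (p' + q' + r')) * ((q + r) / ((q + r) + (q' + r'))) := by
    rw [← integral_prod_expMeasure_exp hl hb (by positivity) (by positivity)]
    refine integral_congr_ae ?_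
    filter_upwards [hpos _ hb] with x ⟨h1, h2⟩
    rw [max_eq_right (by linarith)]; ring_nf
  have e2 : ∫ x, Real.exp (-(p' * (x.1 + x.2)) - q' * x.1 - r' * max (x.1 + x.2) x.1)
      ∂((expMeasure (p + q + r)).prod (expMeasure (p + r))) =
      (p + q + r) / ((p + q + r) + (p' + q' + r')) * ((p + r) / ((p + r) + (p' + r'))) := by
    rw [← integral_prod_expMeasure_exp hl ha (by positivity) (by positivity)]
    refine integral_congr_ae ?_
    filter_upwards [hpos _ ha] with x ⟨h1, h2⟩
    rw [max_eq_left (by linarith)]; ring_nf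
  have e3 : ∫ x, Real.exp (-(p' * x) - q' * x - r' * max x x) ∂(expMeasure (p + q + r)) =
      (p + q + r) / ((p + q + r) + (p' + q' + r')) := by
    rw [← integral_exp_expMeasure hl (by positivity)]
    congr 1 with x
    rw [max_self]; ring_nf
  rw [e1, e2, e3, ENNReal.toReal_ofReal (by positivity), ENNReal.toReal_ofReal (by positivity),
    ENNReal.toReal_ofReal (by positivity), smul_eq_mul, smul_eq_mul, smul_eq_mul]
  have h1 : p + q + r ≠ 0 := hl.ne'
  have h2 : (p + q + r) + (p' + q' + r') ≠ 0 := by positivity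
  have h3 : (q + r) + (q' + r') ≠ 0 := by positivity
  have h4 : (p + r) + (p' + r') ≠ 0 := by positivity
  rw [add_comm (p' + q' + r'), add_comm (q' + r'), add_comm (p' + r')]
  generalize (p + q + r) + (p' + q' + r') = A at *
  generalize (q + r) + (q' + r') = B at *
  generalize (p + r) + (p' + r') = C at *
  field_simp

/-! ### Bernstein functions of a bivariate Lévy measure -/

namespace IsBivariateLevyMeasure

variable {ν : Measure (ℝ × ℝ)}

theorem ae_nonneg (hν : IsBivariateLevyMeasure ν) : ∀ᵐ x ∂ν, 0 ≤ x.1 ∧ 0 ≤ x.2 := hν.support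

theorem integrable_min (hν : IsBivariateLevyMeasure ν) :
    Integrable (fun x : ℝ × ℝ => min 1 (Real.sqrt (x.1 ^ 2 + x.2 ^ 2))) ν := by
  refine ⟨(by fun_prop : Continuous fun x : ℝ × ℝ =>
    min 1 (Real.sqrt (x.1 ^ 2 + x.2 ^ 2))).aestronglyMeasurable, ?_⟩
  rw [hasFiniteIntegral_iff_ofReal (Eventually.of_forall fun x => by positivity)]
  exact hν.lintegral_lt_top

theorem one_sub_exp_le {a b : ℝ} (ha : 0 ≤ a) (hb : 0 ≤ b) {x : ℝ × ℝ} :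
    1 - Real.exp (-a * x.1 - b * x.2) ≤
      (1 + a + b) * min 1 (Real.sqrt (x.1 ^ 2 + x.2 ^ 2)) := by
  have e1 : x.1 ≤ Real.sqrt (x.1 ^ 2 + x.2 ^ 2) := Real.le_sqrt_of_sq_le (by nlinarith)
  have e2 : x.2 ≤ Real.sqrt (x.1 ^ 2 + x.2 ^ 2) := Real.le_sqrt_of_sq_le (by nlinarith)
  have e0 := Real.sqrt_nonneg (x.1 ^ 2 + x.2 ^ 2)
  have h1 := Real.add_one_le_exp (-a * x.1 - b * x.2)
  have h2 := Real.exp_pos (-a * x.1 - b * x.2)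
  rcases min_cases 1 (Real.sqrt (x.1 ^ 2 + x.2 ^ 2)) with ⟨h, _⟩ | ⟨h, _⟩ <;> rw [h]
  · linarith
  · nlinarith [mul_le_mul_of_nonneg_left e1 ha, mul_le_mul_of_nonneg_left e2 hb]

theorem one_sub_exp_nonneg {a b : ℝ} (ha : 0 ≤ a) (hb : 0 ≤ b) {x : ℝ × ℝ}
    (hx : 0 ≤ x.1 ∧ 0 ≤ x.2) : 0 ≤ 1 - Real.exp (-a * x.1 - b * x.2) := by
  rw [sub_nonneg, Real.exp_le_one_iff]
  nlinarith [mul_nonneg ha hx.1, mul_nonneg hb hx.2]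

theorem integrable_one_sub_exp (hν : IsBivariateLevyMeasure ν) {a b : ℝ} (ha : 0 ≤ a)
    (hb : 0 ≤ b) : Integrable (fun x : ℝ × ℝ => 1 - Real.exp (-a * x.1 - b * x.2)) ν := by
  refine Integrable.mono' (hν.integrable_min.const_mul (1 + a + b))
    (by fun_prop : Continuous fun x : ℝ × ℝ =>
      1 - Real.exp (-a * x.1 - b * x.2)).aestronglyMeasurable ?_
  filter_upwards [hν.ae_nonneg] with x hx
  rw [Real.norm_of_nonneg (one_sub_exp_nonneg ha hb hx)]
  exact one_sub_exp_le ha hb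

theorem bernsteinBiv_eq_integral (hν : IsBivariateLevyMeasure ν) (a b : ℝ) :
    bernsteinBiv ν a b = ∫ x, (1 - Real.exp (-a * x.1 - b * x.2)) ∂ν := by
  have h : ∀ᵐ x ∂ν, x ∈ Ici (0 : ℝ) ×ˢ Ici (0 : ℝ) := hν.support
  rw [bernsteinBiv, Measure.restrict_eq_self_of_ae_mem h]

/-- Points with vanishing first coordinate contribute nothing to the integral, so the marginal
exponents are boundary values of the bivariate one. -/
theorem bernsteinUni_marginalLevy₁ (hν : IsBivariateLevyMeasure ν) (a : ℝ) :
    bernsteinUni (marginalLevy₁ ν) a = bernsteinBiv ν a 0 := by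
  rw [bernsteinUni, marginalLevy₁, Measure.restrict_restrict measurableSet_Ioi, inter_self,
    setIntegral_map measurableSet_Ioi (by fun_prop) (by fun_prop), hν.bernsteinBiv_eq_integral]
  simp only [zero_mul, sub_zero]
  refine setIntegral_eq_integral_of_ae_compl_eq_zero ?_
  filter_upwards [hν.ae_nonneg] with x hx h
  have : x.1 = 0 := le_antisymm (by simpa using h) hx.1
  simp [this]

theorem bernsteinUni_marginalLevy₂ (hν : IsBivariateLevyMeasure ν) (b : ℝ) :
    bernsteinUni (marginalLevy₂ ν) b = bernsteinBiv ν 0 b := by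
  rw [bernsteinUni, marginalLevy₂, Measure.restrict_restrict measurableSet_Ioi, inter_self,
    setIntegral_map measurableSet_Ioi (by fun_prop) (by fun_prop), hν.bernsteinBiv_eq_integral]
  simp only [neg_zero, zero_mul, zero_sub, ← neg_mul]
  refine setIntegral_eq_integral_of_ae_compl_eq_zero ?_
  filter_upwards [hν.ae_nonneg] with x hx h
  have : x.2 = 0 := le_antisymm (by simpa using h) hx.2
  simp [this]

theorem bernsteinBiv_zero_right_pos (hν : IsBivariateLevyMeasure ν)
    (h : marginalLevy₁ ν ≠ 0) {a : ℝ} (ha : 0 < a) : 0 < bernsteinBiv ν a 0 := by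
  rw [hν.bernsteinBiv_eq_integral, integral_pos_iff_support_of_nonneg_ae
    (by filter_upwards [hν.ae_nonneg] with x hx using one_sub_exp_nonneg ha.le le_rfl hx)
    (hν.integrable_one_sub_exp ha.le le_rfl)]
  refine pos_iff_ne_zero.2 fun h0 => h ?_
  rw [marginalLevy₁, Measure.restrict_eq_zero, Measure.map_apply measurable_fst measurableSet_Ioi]
  refine measure_mono_null (fun x hx => ?_) h0
  have hx' : 0 < x.1 := hx
  have : Real.exp (-a * x.1 - 0 * x.2) < 1 := by
    rw [Real.exp_lt_one_iff]; nlinarith [mul_pos ha hx']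
  exact (sub_pos.2 this).ne'

theorem bernsteinBiv_zero_left_pos (hν : IsBivariateLevyMeasure ν)
    (h : marginalLevy₂ ν ≠ 0) {b : ℝ} (hb : 0 < b) : 0 < bernsteinBiv ν 0 b := by
  rw [hν.bernsteinBiv_eq_integral, integral_pos_iff_support_of_nonneg_ae
    (by filter_upwards [hν.ae_nonneg] with x hx using one_sub_exp_nonneg le_rfl hb.le hx)
    (hν.integrable_one_sub_exp le_rfl hb.le)]
  refine pos_iff_ne_zero.2 fun h0 => h ?_
  rw [marginalLevy₂, Measure.restrict_eq_zero, Measure.map_apply measurable_snd measurableSet_Ioi]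
  refine measure_mono_null (fun x hx => ?_) h0
  have hx' : 0 < x.2 := hx
  have : Real.exp (-0 * x.1 - b * x.2) < 1 := by
    rw [Real.exp_lt_one_iff]; nlinarith [mul_pos hb hx']
  exact (sub_pos.2 this).ne'

theorem bernsteinBiv_mono (hν : IsBivariateLevyMeasure ν) {a b a' b' : ℝ} (ha : 0 ≤ a)
    (hb : 0 ≤ b) (haa : a ≤ a') (hbb : b ≤ b') : bernsteinBiv ν a b ≤ bernsteinBiv ν a' b' := by
  rw [hν.bernsteinBiv_eq_integral, hν.bernsteinBiv_eq_integral]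
  refine integral_mono_ae (hν.integrable_one_sub_exp ha hb)
    (hν.integrable_one_sub_exp (ha.trans haa) (hb.trans hbb)) ?_
  filter_upwards [hν.ae_nonneg] with x hx
  refine sub_le_sub_left (Real.exp_le_exp.2 ?_) 1
  nlinarith [mul_le_mul_of_nonneg_right haa hx.1, mul_le_mul_of_nonneg_right hbb hx.2]

/-- Pointwise this is `(1 - x)(1 - y) ≥ 0` for `x, y ≤ 1`. It makes the Marshall–Olkin parameter `r`
nonnegative. -/
theorem bernsteinBiv_le_add (hν : IsBivariateLevyMeasure ν) {a b : ℝ} (ha : 0 ≤ a)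
    (hb : 0 ≤ b) : bernsteinBiv ν a b ≤ bernsteinBiv ν a 0 + bernsteinBiv ν 0 b := by
  rw [hν.bernsteinBiv_eq_integral, hν.bernsteinBiv_eq_integral, hν.bernsteinBiv_eq_integral,
    ← integral_add (hν.integrable_one_sub_exp ha le_rfl) (hν.integrable_one_sub_exp le_rfl hb)]
  refine integral_mono_ae (hν.integrable_one_sub_exp ha hb)
    ((hν.integrable_one_sub_exp ha le_rfl).add (hν.integrable_one_sub_exp le_rfl hb)) ?_
  filter_upwards [hν.ae_nonneg] with x hx
  have h1 := one_sub_exp_nonneg ha le_rfl hx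
  have h2 := one_sub_exp_nonneg le_rfl hb hx
  have h3 : Real.exp (-a * x.1 - b * x.2) =
      Real.exp (-a * x.1 - 0 * x.2) * Real.exp (-0 * x.1 - b * x.2) := by
    rw [← Real.exp_add]; ring_nf
  rw [h3]
  nlinarith [mul_nonneg h1 h2]

theorem tendsto_bernsteinBiv (hν : IsBivariateLevyMeasure ν) {a b : ℝ} (ha : 0 ≤ a)
    (hb : 0 ≤ b) :
    Tendsto (fun n : ℕ => bernsteinBiv ν (a + 1 / ((n : ℝ) + 1)) (b + 1 / ((n : ℝ) + 1))) atTop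
      (𝓝 (bernsteinBiv ν a b)) := by
  simp_rw [hν.bernsteinBiv_eq_integral]
  have ht (c : ℝ) : Tendsto (fun n : ℕ => c + 1 / ((n : ℝ) + 1)) atTop (𝓝 c) := by
    simpa using tendsto_one_div_add_atTop_nhds_zero_nat.const_add c
  refine tendsto_integral_of_dominated_convergence
    (fun x => (1 + (a + 1) + (b + 1)) * min 1 (Real.sqrt (x.1 ^ 2 + x.2 ^ 2)))
    (fun n => (by fun_prop : Continuous fun x : ℝ × ℝ => 1 - Real.exp
      (-(a + 1 / ((n : ℝ) + 1)) * x.1 - (b + 1 / ((n : ℝ) + 1)) * x.2)).aestronglyMeasurable)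
    (hν.integrable_min.const_mul _) (fun n => ?_) (Eventually.of_forall fun x => ?_)
  · filter_upwards [hν.ae_nonneg] with x hx
    have h0 : (0 : ℝ) ≤ 1 / ((n : ℝ) + 1) := by positivity
    have h1 : 1 / ((n : ℝ) + 1) ≤ 1 := by
      rw [div_le_one (by positivity)]
      linarith [n.cast_nonneg (α := ℝ)]
    rw [Real.norm_of_nonneg (one_sub_exp_nonneg (by positivity) (by positivity) hx)]
    refine (one_sub_exp_le (by positivity) (by positivity)).trans ?_
    gcongr
  · exact tendsto_const_nhds.sub ((Real.continuous_exp.tendsto _).comp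
      (((ht a).neg.mul_const _).sub ((ht b).mul_const _)))

end IsBivariateLevyMeasure

/-! ### Laplace transforms of a subordinator at one and two times -/

/-- Squeezing `n t` between consecutive integers gives `n |log f(t) + t c| ≤ c` for every `n`.
Monotonicity thus replaces continuity in Cauchy's equation. -/
theorem eq_exp_of_antitone_of_map_add {f : ℝ≥0 → ℝ} (hf : Antitone f)
    (hmul : ∀ s t, f (s + t) = f s * f t) {c : ℝ} (h1 : f 1 = Real.exp (-c)) (t : ℝ≥0) :
    f t = Real.exp (-(t * c)) := by
  have h0 : f 0 = 1 := by
    have := hmul 0 1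
    rw [zero_add, h1] at this
    exact (mul_eq_right₀ (Real.exp_pos _).ne').1 this.symm
  have hpow (s : ℝ≥0) (n : ℕ) : f (n * s) = f s ^ n := by
    induction n with
    | zero => simp [h0]
    | succ n ih => rw [Nat.cast_succ, add_mul, one_mul, hmul, ih, pow_succ]
  have hnat (n : ℕ) : f n = Real.exp (-(n * c)) := by
    have := hpow 1 n
    rw [mul_one, h1, ← Real.exp_nat_mul] at this
    rw [this]; ring_nf
  have hpos (s : ℝ≥0) : 0 < f s := by
    obtain ⟨n, hn⟩ := exists_nat_ge s
    exact ((hnat n).symm ▸ Real.exp_pos _ : 0 < f n).trans_le (hf hn)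
  have hc : 0 ≤ c := by
    have h := hf (zero_le_one (α := ℝ≥0))
    rw [h0, h1, Real.exp_le_one_iff] at h
    linarith
  have key (n : ℕ) : n * |Real.log (f t) + t * c| ≤ c := by
    have hk1 : ((⌊(n : ℝ≥0) * t⌋₊ : ℕ) : ℝ≥0) ≤ n * t := Nat.floor_le (by positivity)
    have hk2 : (n : ℝ≥0) * t ≤ ((⌊(n : ℝ≥0) * t⌋₊ + 1 : ℕ) : ℝ≥0) := by
      exact_mod_cast (Nat.lt_floor_add_one ((n : ℝ≥0) * t)).le
    have e1 := hf hk1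
    have e2 := hf hk2
    rw [hnat, hpow] at e1 e2
    have l1 := Real.log_le_log (pow_pos (hpos t) n) e1
    have l2 := Real.log_le_log (Real.exp_pos _) e2
    rw [Real.log_exp, Real.log_pow] at l1 l2
    have r1 : ((⌊(n : ℝ≥0) * t⌋₊ : ℕ) : ℝ) ≤ n * t := by exact_mod_cast hk1
    have r2 : (n : ℝ) * t ≤ ((⌊(n : ℝ≥0) * t⌋₊ + 1 : ℕ) : ℝ) := by exact_mod_cast hk2
    push_cast at r2 l2
    rw [← abs_of_nonneg (n.cast_nonneg (α := ℝ)), ← abs_mul, abs_le]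
    constructor <;> nlinarith [mul_le_mul_of_nonneg_right r1 hc, mul_le_mul_of_nonneg_right r2 hc]
  have hz : Real.log (f t) + t * c = 0 := by
    by_contra hne
    have hp := abs_pos.2 hne
    obtain ⟨n, hn⟩ := exists_nat_gt (c / |Real.log (f t) + t * c|)
    rw [div_lt_iff₀ hp] at hn
    exact absurd (key n) (not_le.2 hn)
  rw [← Real.exp_log (hpos t)]
  congr 1; linarith

theorem exp_neg_mul_sub_mul_le_one {a b x y : ℝ} (ha : 0 ≤ a) (hb : 0 ≤ b) (hx : 0 ≤ x) (hy : 0 ≤ y) :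
    Real.exp (-a * x - b * y) ≤ 1 := by
  rw [Real.exp_le_one_iff]
  nlinarith [mul_nonneg ha hx, mul_nonneg hb hy]

namespace IsBivariateSubordinator

variable {Ω : Type*} [MeasurableSpace Ω] {P : Measure Ω}
  {X : ℝ≥0 → Ω → ℝ × ℝ} {ν : Measure (ℝ × ℝ)}

theorem ae_nonneg (hX : IsBivariateSubordinator X ν P) :
    ∀ᵐ ω ∂P, ∀ t, 0 ≤ (X t ω).1 ∧ 0 ≤ (X t ω).2 := by
  filter_upwards [hX.levy.start, hX.mono] with ω h0 ⟨h1, h2⟩ t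
  have e1 := h1 (zero_le : 0 ≤ t)
  have e2 := h2 (zero_le : 0 ≤ t)
  simp only [h0, Prod.fst_zero, Prod.snd_zero] at e1 e2
  exact ⟨e1, e2⟩

theorem integral_exp_increment (hX : IsBivariateSubordinator X ν P) (a b c d : ℝ) (s t : ℝ≥0) :
    ∫ ω, Real.exp (-a * (X s ω).1 - b * (X s ω).2) *
      Real.exp (-c * ((X (s + t) ω).1 - (X s ω).1) - d * ((X (s + t) ω).2 - (X s ω).2)) ∂P =
    (∫ ω, Real.exp (-a * (X s ω).1 - b * (X s ω).2) ∂P) *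
      ∫ ω, Real.exp (-c * (X t ω).1 - d * (X t ω).2) ∂P := by
  have hi := hX.levy.indep.indepFun_eval_sub (zero_le : 0 ≤ s) (self_le_add_right s t)
    hX.levy.start
  have hm (a b : ℝ) : Measurable fun x : ℝ × ℝ => Real.exp (-a * x.1 - b * x.2) := by fun_prop
  have h2 := hi.comp (hm a b) (hm c d)
  have h3 := (hX.levy.stationary s t).comp (hm c d)
  have h4 : ∫ ω, Real.exp (-c * ((X (s + t) ω).1 - (X s ω).1) -
      d * ((X (s + t) ω).2 - (X s ω).2)) ∂P =
      ∫ ω, Real.exp (-c * (X t ω).1 - d * (X t ω).2) ∂P := h3.integral_eq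
  rw [← h4]
  have hs := hX.levy.measurable s
  have hst := hX.levy.measurable (s + t)
  exact h2.integral_fun_mul_eq_mul_integral (by fun_prop : Measurable _).aestronglyMeasurable
    (by fun_prop : Measurable _).aestronglyMeasurable

variable [IsProbabilityMeasure P]

theorem integrable_exp (hX : IsBivariateSubordinator X ν P) {a b : ℝ} (ha : 0 ≤ a) (hb : 0 ≤ b)
    (s t : ℝ≥0) : Integrable (fun ω => Real.exp (-a * (X s ω).1 - b * (X t ω).2)) P := by
  have hs := hX.levy.measurable s
  have ht := hX.levy.measurable t
  refine Integrable.of_bound (by fun_prop : Measurable _).aestronglyMeasurable 1 ?_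
  filter_upwards [hX.ae_nonneg] with ω h
  rw [Real.norm_of_nonneg (Real.exp_pos _).le]
  exact exp_neg_mul_sub_mul_le_one ha hb (h s).1 (h t).2

/-- The Laplace exponent is prescribed only for positive arguments; dominated convergence along `a +
1/(n+1)`, `b + 1/(n+1)` reaches the axes, where the marginals live. -/
theorem integral_exp_one (hX : IsBivariateSubordinator X ν P) {a b : ℝ} (ha : 0 ≤ a)
    (hb : 0 ≤ b) :
    ∫ ω, Real.exp (-a * (X 1 ω).1 - b * (X 1 ω).2) ∂P = Real.exp (-bernsteinBiv ν a b) := by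
  have ht (c : ℝ) : Tendsto (fun n : ℕ => c + 1 / ((n : ℝ) + 1)) atTop (𝓝 c) := by
    simpa using tendsto_one_div_add_atTop_nhds_zero_nat.const_add c
  have hm := hX.levy.measurable 1
  have h1 : Tendsto (fun n : ℕ => ∫ ω, Real.exp (-(a + 1 / ((n : ℝ) + 1)) * (X 1 ω).1 -
      (b + 1 / ((n : ℝ) + 1)) * (X 1 ω).2) ∂P) atTop
      (𝓝 (∫ ω, Real.exp (-a * (X 1 ω).1 - b * (X 1 ω).2) ∂P)) := by
    refine tendsto_integral_of_dominated_convergence (fun _ => 1)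
      (fun n => (by fun_prop : Measurable _).aestronglyMeasurable) (integrable_const _)
      (fun n => ?_) (Eventually.of_forall fun ω => ?_)
    · filter_upwards [hX.ae_nonneg] with ω h
      rw [Real.norm_of_nonneg (Real.exp_pos _).le]
      exact exp_neg_mul_sub_mul_le_one (by positivity) (by positivity) (h 1).1 (h 1).2
    · exact (Real.continuous_exp.tendsto _).comp
        (((ht a).neg.mul_const _).sub ((ht b).mul_const _))
  have h2 := (Real.continuous_exp.tendsto _).comp (hX.levyMeasure.tendsto_bernsteinBiv ha hb).neg
  refine tendsto_nhds_unique h1 (h2.congr fun n => ?_)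
  exact (hX.laplace _ _ (by positivity) (by positivity)).symm

theorem integral_exp (hX : IsBivariateSubordinator X ν P) {a b : ℝ} (ha : 0 ≤ a)
    (hb : 0 ≤ b) (t : ℝ≥0) :
    ∫ ω, Real.exp (-a * (X t ω).1 - b * (X t ω).2) ∂P = Real.exp (-(t * bernsteinBiv ν a b)) := by
  refine eq_exp_of_antitone_of_map_add
    (f := fun t => ∫ ω, Real.exp (-a * (X t ω).1 - b * (X t ω).2) ∂P) ?_ ?_
    (hX.integral_exp_one ha hb) t
  · intro s t hst
    refine integral_mono_ae (hX.integrable_exp ha hb t t) (hX.integrable_exp ha hb s s) ?_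
    filter_upwards [hX.mono] with ω ⟨h1, h2⟩
    refine Real.exp_le_exp.2 ?_
    have e1 : (X s ω).1 ≤ (X t ω).1 := h1 hst
    have e2 : (X s ω).2 ≤ (X t ω).2 := h2 hst
    nlinarith [mul_le_mul_of_nonneg_left e1 ha, mul_le_mul_of_nonneg_left e2 hb]
  · intro s t
    rw [← hX.integral_exp_increment a b a b s t]
    congr 1 with ω
    rw [← Real.exp_add]; ring_nf

/-- The joint Laplace transform of the coordinates at two times: the survival function of a
Marshall–Olkin law. -/
theorem integral_exp_two_times (hX : IsBivariateSubordinator X ν P) {a b : ℝ} (ha : 0 ≤ a)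
    (hb : 0 ≤ b) (u v : ℝ≥0) :
    ∫ ω, Real.exp (-a * (X u ω).1 - b * (X v ω).2) ∂P =
      Real.exp (-((bernsteinBiv ν a b - bernsteinBiv ν 0 b) * u) -
        (bernsteinBiv ν a b - bernsteinBiv ν a 0) * v -
        (bernsteinBiv ν a 0 + bernsteinBiv ν 0 b - bernsteinBiv ν a b) * max (u : ℝ) v) := by
  rcases le_total u v with h | h
  · obtain ⟨t, rfl⟩ := exists_add_of_le h
    -- After time `u` only the second coordinate still counts, so the increment carries the weights
    -- `(0, b)`.
    have h1 := hX.integral_exp_increment a b 0 b u t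
    rw [hX.integral_exp ha hb, hX.integral_exp le_rfl hb, ← Real.exp_add] at h1
    have h2 : (u : ℝ) ≤ ((u + t : ℝ≥0) : ℝ) := by exact_mod_cast h
    rw [max_eq_right h2, NNReal.coe_add]
    refine Eq.trans ?_ (h1.trans ?_)
    · congr 1 with ω
      rw [← Real.exp_add]; ring_nf
    · ring_nf
  · obtain ⟨t, rfl⟩ := exists_add_of_le h
    have h1 := hX.integral_exp_increment a b a 0 v t
    rw [hX.integral_exp ha hb, hX.integral_exp ha le_rfl, ← Real.exp_add] at h1
    have h2 : (v : ℝ) ≤ ((v + t : ℝ≥0) : ℝ) := by exact_mod_cast h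
    rw [max_eq_left h2, NNReal.coe_add]
    refine Eq.trans ?_ (h1.trans ?_)
    · congr 1 with ω
      rw [← Real.exp_add]; ring_nf
    · ring_nf

end IsBivariateSubordinator

/-! ### Paths and their inverses -/

/-- A non-negative, non-decreasing, right-continuous, unbounded path. -/
structure IsSubordinatorPath (y : ℝ≥0 → ℝ) : Prop where
  mono : Monotone y
  nonneg : ∀ u, 0 ≤ y u
  rightCont : ∀ u, ContinuousWithinAt y (Ici u) u
  unbounded : ∀ t : ℝ, ∃ u, t < y u

section

variable {Ω : Type*} {Y : ℝ≥0 → Ω → ℝ} {ω : Ω}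

namespace IsSubordinatorPath

theorem nonempty (h : IsSubordinatorPath (Y · ω)) (t : ℝ) :
    {u : ℝ≥0 | 0 < u ∧ t < Y u ω}.Nonempty := by
  obtain ⟨u, hu⟩ := h.unbounded t
  exact ⟨u + 1, by positivity, hu.trans_le (h.mono (self_le_add_right u 1))⟩

/-- Were the infimum at most `u`, the path would exceed `t` at every time after `u`, and
right-continuity would force `t ≤ Y u`. -/
theorem lt_rightInverse (h : IsSubordinatorPath (Y · ω)) {u : ℝ≥0} {t : ℝ} (ht : Y u ω < t) :
    u < rightInverse Y t ω := by
  by_contra! hle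
  refine not_le.2 ht ?_
  have hc : Tendsto (Y · ω) (𝓝[>] u) (𝓝 (Y u ω)) :=
    (h.rightCont u).mono Ioi_subset_Ici_self
  refine ge_of_tendsto hc ?_
  filter_upwards [self_mem_nhdsWithin] with w hw
  obtain ⟨a, ⟨_, ha⟩, haw⟩ := exists_lt_of_csInf_lt (h.nonempty t) (hle.trans_lt hw)
  exact ha.le.trans (h.mono haw.le)

theorem le_of_lt_rightInverse (h : IsSubordinatorPath (Y · ω)) {u : ℝ≥0} {t : ℝ}
    (hu : u < rightInverse Y t ω) : Y u ω ≤ t := by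
  obtain ⟨w, huw, hw⟩ := exists_between hu
  by_contra! hlt
  exact notMem_of_lt_csInf hw (OrderBot.bddBelow _)
    ⟨(zero_le.trans_lt huw), hlt.trans_le (h.mono huw.le)⟩

/-- The event lies between `Y u < t` and `Y u ≤ t`, which differ by one point, null for the
exponential law. -/
theorem expMeasure_lt_rightInverse (h : IsSubordinatorPath (Y · ω)) {z : ℝ} (hz : 0 < z)
    (u : ℝ≥0) : expMeasure z {t | u < rightInverse Y t ω} =
      ENNReal.ofReal (Real.exp (-(z * Y u ω))) := by
  rw [← expMeasure_Ioi_of_nonneg hz (h.nonneg u)]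
  refine le_antisymm ?_ (measure_mono fun t ht => h.lt_rightInverse ht)
  rw [measure_congr Ioi_ae_eq_Ici]
  exact measure_mono fun t ht => h.le_of_lt_rightInverse ht

end IsSubordinatorPath

/-- The right-continuous inverse computed along a countable dense set of times: a jointly
measurable version of `rightInverse`. -/
noncomputable def denseInverse (Y : ℝ≥0 → Ω → ℝ) (t : ℝ) (ω : Ω) : ℝ≥0 :=
  (⨅ n : ℕ, if 0 < TopologicalSpace.denseSeq ℝ≥0 n ∧ t < Y (TopologicalSpace.denseSeq ℝ≥0 n) ω
    then (TopologicalSpace.denseSeq ℝ≥0 n : ℝ≥0∞) else ⊤).toNNReal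

theorem measurable_denseInverse [MeasurableSpace Ω] (hY : ∀ u, Measurable (Y u)) :
    Measurable fun x : ℝ × Ω => denseInverse Y x.1 x.2 := by
  refine ENNReal.measurable_toNNReal.comp (Measurable.iInf fun n => ?_)
  refine Measurable.ite ((MeasurableSet.const _).inter
    (measurableSet_lt measurable_fst ((hY _).comp measurable_snd))) measurable_const
    measurable_const

theorem IsSubordinatorPath.denseInverse_eq (h : IsSubordinatorPath (Y · ω)) (t : ℝ) :
    denseInverse Y t ω = rightInverse Y t ω := by
  rw [denseInverse, ← ENNReal.toNNReal_coe (rightInverse Y t ω)]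
  congr 1
  refine le_antisymm ?_ ?_
  · refine ENNReal.le_of_forall_pos_le_add fun ε hε _ => ?_
    have hlt : rightInverse Y t ω < rightInverse Y t ω + ε := lt_add_of_pos_right _ hε
    obtain ⟨a, ⟨ha0, ha⟩, haw⟩ := exists_lt_of_csInf_lt (h.nonempty t) hlt
    obtain ⟨n, hn1, hn2⟩ := (TopologicalSpace.denseRange_denseSeq ℝ≥0).exists_mem_open
      isOpen_Ioo (nonempty_Ioo.2 haw)
    refine (iInf_le _ n).trans ?_
    rw [if_pos ⟨ha0.trans hn1, ha.trans_le (h.mono hn1.le)⟩]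
    exact_mod_cast hn2.le
  · refine le_iInf fun n => ?_
    split_ifs with hn
    · exact ENNReal.coe_le_coe.2
        (csInf_le (s := {u : ℝ≥0 | 0 < u ∧ t < Y u ω}) (OrderBot.bddBelow _) hn)
    · exact le_top

/-- By Markov's inequality for `exp(-Y n)`, a path bounded by `k` has probability at most `exp(k - n
c)` for every `n`. -/
theorem ae_unbounded_of_integral_exp [MeasurableSpace Ω] {P : Measure Ω} [IsProbabilityMeasure P]
    (hint : ∀ u, Integrable (fun ω => Real.exp (-Y u ω)) P) {c : ℝ} (hc : 0 < c)
    (hlap : ∀ u : ℝ≥0, ∫ ω, Real.exp (-Y u ω) ∂P = Real.exp (-(u * c))) :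
    ∀ᵐ ω ∂P, ∀ t : ℝ, ∃ u, t < Y u ω := by
  have key (k : ℕ) : ∀ᵐ ω ∂P, ∃ u, (k : ℝ) < Y u ω := by
    have hb (n : ℕ) : P.real {ω | ¬ ∃ u, (k : ℝ) < Y u ω} ≤ Real.exp (k - n * c) := by
      have h1 := mul_meas_ge_le_integral_of_nonneg
        (Eventually.of_forall fun ω => (Real.exp_pos (-Y n ω)).le) (hint n) (Real.exp (-k))
      rw [hlap] at h1
      have h2 : P.real {ω | ¬ ∃ u, (k : ℝ) < Y u ω} ≤
          P.real {ω | Real.exp (-k) ≤ Real.exp (-Y n ω)} := by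
        refine measureReal_mono fun ω hω => Real.exp_le_exp.2 ?_
        push Not at hω
        exact neg_le_neg (hω n)
      refine h2.trans ?_
      rw [← mul_le_mul_iff_right₀ (Real.exp_pos (-(k : ℝ))), ← Real.exp_add]
      refine h1.trans (le_of_eq ?_)
      simp only [NNReal.coe_natCast]
      ring_nf
    have ht : Tendsto (fun n : ℕ => Real.exp (k - n * c)) atTop (𝓝 0) := by
      refine Real.tendsto_exp_atBot.comp ?_
      exact tendsto_atBot_add_const_left _ _
        (tendsto_neg_atTop_atBot.comp (tendsto_natCast_atTop_atTop.atTop_mul_const hc))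
    have h0 := le_antisymm (ge_of_tendsto' ht hb) measureReal_nonneg
    exact (measureReal_eq_zero_iff).1 h0
  filter_upwards [ae_all_iff.2 key] with ω h t
  obtain ⟨k, hk⟩ := exists_nat_gt t
  obtain ⟨u, hu⟩ := h k
  exact ⟨u, hk.trans hu⟩

end

namespace IsBivariateSubordinator

variable {Ω : Type*} [MeasurableSpace Ω] {P : Measure Ω} [IsProbabilityMeasure P]
  {X : ℝ≥0 → Ω → ℝ × ℝ} {ν : Measure (ℝ × ℝ)}

theorem ae_isSubordinatorPath (hX : IsBivariateSubordinator X ν P)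
    (h₁ : marginalLevy₁ ν ≠ 0) (h₂ : marginalLevy₂ ν ≠ 0) :
    ∀ᵐ ω ∂P, IsSubordinatorPath (fun u => (X u ω).1) ∧ IsSubordinatorPath (fun u => (X u ω).2) := by
  have u1 := ae_unbounded_of_integral_exp (P := P) (Y := fun u ω => (X u ω).1)
    (fun u => by simpa using hX.integrable_exp zero_le_one le_rfl u u)
    (hX.levyMeasure.bernsteinBiv_zero_right_pos h₁ one_pos)
    (fun u => by simpa using hX.integral_exp zero_le_one le_rfl u)
  have u2 := ae_unbounded_of_integral_exp (P := P) (Y := fun u ω => (X u ω).2)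
    (fun u => by simpa using hX.integrable_exp le_rfl zero_le_one u u)
    (hX.levyMeasure.bernsteinBiv_zero_left_pos h₂ one_pos)
    (fun u => by simpa using hX.integral_exp le_rfl zero_le_one u)
  filter_upwards [hX.mono, hX.ae_nonneg, hX.levy.cadlag, u1, u2] with ω hm hn hc h1 h2
  exact ⟨⟨hm.1, fun u => (hn u).1, fun u => (hc u).1.fst, h1⟩,
    ⟨hm.2, fun u => (hn u).2, fun u => (hc u).1.snd, h2⟩⟩

end IsBivariateSubordinator

/-! ### Evaluation at independent random times -/

/-- Evaluating a countable family of random variables at an independent random index. -/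
theorem integral_eval_of_indepFun {Ω ι : Type*} [MeasurableSpace Ω] {P : Measure Ω}
    [IsProbabilityMeasure P] [Countable ι] [MeasurableSpace ι] [MeasurableSingletonClass ι]
    {K : Ω → ι} {W : ι → Ω → ℝ} (hK : Measurable K) (hW : ∀ i, Measurable (W i))
    (hind : IndepFun K (fun ω i => W i ω) P) (hb : ∀ᵐ ω ∂P, ∀ i, ‖W i ω‖ ≤ 1) :
    ∫ ω, W (K ω) ω ∂P = ∫ ω, (∫ ω', W (K ω) ω' ∂P) ∂P := by
  have hW' : Measurable fun ω i => W i ω := measurable_pi_lambda _ hW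
  -- Joint measurability of evaluation rests on countability of the index set; hence the
  -- discretisation of time below.
  have hf : Measurable fun x : ι × (ι → ℝ) => x.2 x.1 :=
    measurable_from_prod_countable_right fun i => measurable_pi_apply i
  have hmap := (indepFun_iff_map_prod_eq_prod_map_map hK.aemeasurable hW'.aemeasurable).1 hind
  have : IsProbabilityMeasure (P.map K) := Measure.isProbabilityMeasure_map hK.aemeasurable
  have : IsProbabilityMeasure (P.map fun ω i => W i ω) :=
    Measure.isProbabilityMeasure_map hW'.aemeasurable
  have h1 : ∫ ω, W (K ω) ω ∂P =
      ∫ x, x.2 x.1 ∂((P.map K).prod (P.map fun ω i => W i ω)) := by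
    rw [← hmap, integral_map (hK.prodMk hW').aemeasurable hf.aestronglyMeasurable]
  have hint : Integrable (fun x : ι × (ι → ℝ) => x.2 x.1)
      ((P.map K).prod (P.map fun ω i => W i ω)) := by
    rw [← hmap, integrable_map_measure hf.aestronglyMeasurable (hK.prodMk hW').aemeasurable]
    refine Integrable.of_bound (hf.comp (hK.prodMk hW')).aestronglyMeasurable 1 ?_
    filter_upwards [hb] with ω h using h (K ω)
  rw [h1, integral_prod _ hint, integral_map hK.aemeasurable
    (measurable_of_countable _).aestronglyMeasurable]
  congr 1 with ω
  rw [integral_map hW'.aemeasurable (measurable_pi_apply _).aestronglyMeasurable]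

/-- The positive multiples of `1 / (n + 1)`. -/
noncomputable def gridPoint (n k : ℕ) : ℝ≥0 := ((k + 1 : ℕ) : ℝ≥0) / ((n : ℝ≥0) + 1)

/-- The smallest multiple of `1 / (n + 1)` above `l`. -/
noncomputable def ceilGrid (n : ℕ) (l : ℝ≥0) : ℝ≥0 := gridPoint n ⌊((n : ℝ≥0) + 1) * l⌋₊

theorem lt_ceilGrid (n : ℕ) (l : ℝ≥0) : l < ceilGrid n l := by
  rw [ceilGrid, gridPoint, lt_div_iff₀ (by positivity), mul_comm]
  exact_mod_cast Nat.lt_floor_add_one (((n : ℝ≥0) + 1) * l)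

theorem ceilGrid_le (n : ℕ) (l : ℝ≥0) : ceilGrid n l ≤ l + 1 / ((n : ℝ≥0) + 1) := by
  have h := Nat.floor_le (zero_le : 0 ≤ ((n : ℝ≥0) + 1) * l)
  have h0 : (n : ℝ≥0) + 1 ≠ 0 := by positivity
  have e : (l + 1 / ((n : ℝ≥0) + 1)) * ((n : ℝ≥0) + 1) = ((n : ℝ≥0) + 1) * l + 1 := by
    rw [add_mul, div_mul_cancel₀ _ h0, mul_comm]
  rw [ceilGrid, gridPoint, div_le_iff₀ (by positivity), e, Nat.cast_succ]
  gcongr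

/-- The approach is from above, so right-continuous paths converge along it. -/
theorem tendsto_ceilGrid (l : ℝ≥0) : Tendsto (fun n => ceilGrid n l) atTop (𝓝[≥] l) := by
  refine tendsto_nhdsWithin_iff.2 ⟨?_, Eventually.of_forall fun n => (lt_ceilGrid n l).le⟩
  have h : Tendsto (fun n : ℕ => l + 1 / ((n : ℝ≥0) + 1)) atTop (𝓝 l) := by
    simpa using tendsto_one_div_add_atTop_nhds_zero_nat.const_add l
  exact tendsto_of_tendsto_of_tendsto_of_le_of_le tendsto_const_nhds h
    (fun n => (lt_ceilGrid n l).le) (fun n => ceilGrid_le n l)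

section

variable {Ω E : Type*} [MeasurableSpace Ω] [MeasurableSpace E] {X : ℝ≥0 → Ω → E}

theorem measurable_nat_floor_mul (n : ℕ) {K : Ω → ℝ≥0} (hK : Measurable K) :
    Measurable fun ω => ⌊((n : ℝ≥0) + 1) * K ω⌋₊ :=
  Nat.measurable_floor.comp (hK.const_mul ((n : ℝ≥0) + 1))

theorem measurable_eval_gridPoint (hX : ∀ t, Measurable (X t)) {k : Ω → ℕ} (hk : Measurable k)
    (n : ℕ) : Measurable fun ω => X (gridPoint n (k ω)) ω := by
  have hf : Measurable fun x : ℕ × Ω => X (gridPoint n x.1) x.2 :=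
    measurable_from_prod_countable_right fun i => hX (gridPoint n i)
  exact hf.comp (hk.prodMk measurable_id)

theorem measurable_eval_ceilGrid (hX : ∀ t, Measurable (X t)) {K : Ω → ℝ≥0}
    (hK : Measurable K) (n : ℕ) : Measurable fun ω => X (ceilGrid n (K ω)) ω :=
  measurable_eval_gridPoint hX (measurable_nat_floor_mul n hK) n

end

namespace IsBivariateSubordinator

variable {Ω : Type*} [MeasurableSpace Ω] {P : Measure Ω}
  {X : ℝ≥0 → Ω → ℝ × ℝ} {ν : Measure (ℝ × ℝ)}

theorem tendsto_exp_ceilGrid (hX : IsBivariateSubordinator X ν P) (a b : ℝ) (K L : Ω → ℝ≥0) :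
    ∀ᵐ ω ∂P, Tendsto (fun n => Real.exp (-a * (X (ceilGrid n (K ω)) ω).1 -
      b * (X (ceilGrid n (L ω)) ω).2)) atTop
      (𝓝 (Real.exp (-a * (X (K ω) ω).1 - b * (X (L ω) ω).2))) := by
  filter_upwards [hX.levy.cadlag] with ω hc
  have h1 := ((hc (K ω)).1.fst.tendsto.comp (tendsto_ceilGrid (K ω)))
  have h2 := ((hc (L ω)).1.snd.tendsto.comp (tendsto_ceilGrid (L ω)))
  exact (Real.continuous_exp.tendsto _).comp ((h1.const_mul (-a)).sub (h2.const_mul b))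

theorem measurable_exp_ceilGrid (hX : IsBivariateSubordinator X ν P) (a b : ℝ) {K L : Ω → ℝ≥0}
    (hK : Measurable K) (hL : Measurable L) (n : ℕ) :
    Measurable fun ω => Real.exp (-a * (X (ceilGrid n (K ω)) ω).1 -
      b * (X (ceilGrid n (L ω)) ω).2) := by
  have h1 := measurable_eval_ceilGrid hX.levy.measurable hK n
  have h2 := measurable_eval_ceilGrid hX.levy.measurable hL n
  exact Real.measurable_exp.comp ((h1.fst.const_mul (-a)).sub (h2.snd.const_mul b))

variable [IsProbabilityMeasure P]

/-- The Laplace transform of a subordinator at random times independent of it. -/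
theorem integral_exp_random_times (hX : IsBivariateSubordinator X ν P) {a b : ℝ} (ha : 0 ≤ a)
    (hb : 0 ≤ b) {K L : Ω → ℝ≥0} (hK : Measurable K) (hL : Measurable L)
    (hind : IndepFun (fun ω => (K ω, L ω)) (fun ω u => X u ω) P) :
    Integrable (fun ω => Real.exp (-a * (X (K ω) ω).1 - b * (X (L ω) ω).2)) P ∧
    ∫ ω, Real.exp (-a * (X (K ω) ω).1 - b * (X (L ω) ω).2) ∂P =
      ∫ ω, Real.exp (-((bernsteinBiv ν a b - bernsteinBiv ν 0 b) * K ω) -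
        (bernsteinBiv ν a b - bernsteinBiv ν a 0) * L ω -
        (bernsteinBiv ν a 0 + bernsteinBiv ν 0 b - bernsteinBiv ν a b) *
          max (K ω : ℝ) (L ω)) ∂P := by
  have hbound : ∀ᵐ ω ∂P, ∀ s t : ℝ≥0,
      ‖Real.exp (-a * (X s ω).1 - b * (X t ω).2)‖ ≤ 1 := by
    filter_upwards [hX.ae_nonneg] with ω h s t
    rw [Real.norm_of_nonneg (Real.exp_pos _).le]
    exact exp_neg_mul_sub_mul_le_one ha hb (h s).1 (h t).2
  have hlim := hX.tendsto_exp_ceilGrid a b K L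
  have hmeas := hX.measurable_exp_ceilGrid a b hK hL
  -- Each process variable is measurable only at a fixed time; at random times measurability is
  -- inherited, almost everywhere, from the grid approximations.
  have haem := aemeasurable_of_tendsto_metrizable_ae atTop (fun n => (hmeas n).aemeasurable) hlim
  refine ⟨Integrable.of_bound haem.aestronglyMeasurable 1
    (by filter_upwards [hbound] with ω h using h _ _), ?_⟩
  set p := bernsteinBiv ν a b - bernsteinBiv ν 0 b with hp
  set q := bernsteinBiv ν a b - bernsteinBiv ν a 0 with hq
  set r := bernsteinBiv ν a 0 + bernsteinBiv ν 0 b - bernsteinBiv ν a b with hr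
  have hp0 : 0 ≤ p := sub_nonneg.2 (hX.levyMeasure.bernsteinBiv_mono le_rfl hb ha le_rfl)
  have hq0 : 0 ≤ q := sub_nonneg.2 (hX.levyMeasure.bernsteinBiv_mono ha le_rfl le_rfl hb)
  have hr0 : 0 ≤ r := sub_nonneg.2 (hX.levyMeasure.bernsteinBiv_le_add ha hb)
  have hlhs := tendsto_integral_of_dominated_convergence (fun _ => (1 : ℝ))
    (fun n => (hmeas n).aestronglyMeasurable) (integrable_const _)
    (fun n => by filter_upwards [hbound] with ω h using h _ _) hlim
  have hmc (n : ℕ) : Measurable (ceilGrid n) :=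
    (measurable_from_nat (f := gridPoint n)).comp
      (Nat.measurable_floor.comp (measurable_const_mul _))
  have hrhs : Tendsto (fun n => ∫ ω, Real.exp (-(p * ceilGrid n (K ω)) - q * ceilGrid n (L ω) -
      r * max (ceilGrid n (K ω) : ℝ) (ceilGrid n (L ω))) ∂P) atTop
      (𝓝 (∫ ω, Real.exp (-(p * K ω) - q * L ω - r * max (K ω : ℝ) (L ω)) ∂P)) := by
    refine tendsto_integral_of_dominated_convergence (fun _ => (1 : ℝ)) (fun n => ?_)
      (integrable_const _) (fun n => Eventually.of_forall fun ω => ?_)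
      (Eventually.of_forall fun ω => ?_)
    · have h1 := (hmc n).comp hK
      have h2 := (hmc n).comp hL
      simp only [Function.comp_def] at h1 h2
      exact (by fun_prop : Measurable _).aestronglyMeasurable
    · rw [Real.norm_of_nonneg (Real.exp_pos _).le, Real.exp_le_one_iff]
      have : 0 ≤ p * ceilGrid n (K ω) + q * ceilGrid n (L ω) +
        r * max (ceilGrid n (K ω) : ℝ) (ceilGrid n (L ω)) := by positivity
      linarith
    · have h1 : Tendsto (fun n => (ceilGrid n (K ω) : ℝ)) atTop (𝓝 (K ω)) :=
        NNReal.tendsto_coe.2 (tendsto_nhds_of_tendsto_nhdsWithin (tendsto_ceilGrid (K ω)))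
      have h2 : Tendsto (fun n => (ceilGrid n (L ω) : ℝ)) atTop (𝓝 (L ω)) :=
        NNReal.tendsto_coe.2 (tendsto_nhds_of_tendsto_nhdsWithin (tendsto_ceilGrid (L ω)))
      exact (Real.continuous_exp.tendsto _).comp
        (((h1.const_mul p).neg.sub (h2.const_mul q)).sub ((h1.max h2).const_mul r))
  refine tendsto_nhds_unique hlhs (hrhs.congr fun n => ?_)
  have hc : Measurable fun x : ℝ≥0 × ℝ≥0 =>
      (⌊((n : ℝ≥0) + 1) * x.1⌋₊, ⌊((n : ℝ≥0) + 1) * x.2⌋₊) :=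
    (Nat.measurable_floor.comp (measurable_fst.const_mul _)).prodMk
      (Nat.measurable_floor.comp (measurable_snd.const_mul _))
  have hd : Measurable fun (x : ℝ≥0 → ℝ × ℝ) (i : ℕ × ℕ) => Real.exp
      (-a * (x (gridPoint n i.1)).1 -
        b * (x (gridPoint n i.2)).2) := by
    fun_prop
  -- For fixed `n` the pair of grid times is indexed by two natural numbers, so the countable case
  -- applies, with the two-time formula as inner expectation.
  have h := integral_eval_of_indepFun (P := P)
    (K := fun ω => (⌊((n : ℝ≥0) + 1) * K ω⌋₊, ⌊((n : ℝ≥0) + 1) * L ω⌋₊))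
    (W := fun i ω => Real.exp
      (-a * (X (gridPoint n i.1) ω).1 -
        b * (X (gridPoint n i.2) ω).2))
    (hc.comp (hK.prodMk hL)) (fun i => ?_) (hind.comp hc hd)
    (by filter_upwards [hbound] with ω h i using h _ _)
  · refine Eq.trans ?_ h.symm
    congr 1 with ω
    exact (hX.integral_exp_two_times ha hb _ _).symm
  · have h1 := hX.levy.measurable (gridPoint n i.1)
    have h2 := hX.levy.measurable (gridPoint n i.2)
    fun_prop

end IsBivariateSubordinator

/-! ### The inverses at exponential times -/

namespace IsBivariateSubordinator

variable {Ω : Type*} [MeasurableSpace Ω] {P : Measure Ω}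
  {T : ℝ≥0 → Ω → ℝ × ℝ} {μ : Measure (ℝ × ℝ)}

theorem measurable_inversePair (hT : IsBivariateSubordinator T μ P) :
    Measurable fun x : Ω × ℝ × ℝ =>
      ((denseInverse (fun u ω => (T u ω).1) x.2.1 x.1 : ℝ),
        (denseInverse (fun u ω => (T u ω).2) x.2.2 x.1 : ℝ)) := by
  have h1 := measurable_denseInverse (Y := fun u ω => (T u ω).1)
    fun u => (hT.levy.measurable u).fst
  have h2 := measurable_denseInverse (Y := fun u ω => (T u ω).2)
    fun u => (hT.levy.measurable u).snd
  exact ((h1.comp ((measurable_fst.comp measurable_snd).prodMk measurable_fst)).coe_nnreal_real).prodMk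
    ((h2.comp ((measurable_snd.comp measurable_snd).prodMk measurable_fst)).coe_nnreal_real)

variable [IsProbabilityMeasure P]

/-- The inverses of the coordinates of a subordinator at independent exponential times have a
Marshall–Olkin law. -/
theorem map_inversePair (hT : IsBivariateSubordinator T μ P)
    (hμ₁ : marginalLevy₁ μ ≠ 0) (hμ₂ : marginalLevy₂ μ ≠ 0) {z₁ z₂ : ℝ} (hz₁ : 0 < z₁)
    (hz₂ : 0 < z₂) :
    (P.prod ((expMeasure z₁).prod (expMeasure z₂))).map (fun x : Ω × ℝ × ℝ =>
      ((denseInverse (fun u ω => (T u ω).1) x.2.1 x.1 : ℝ),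
        (denseInverse (fun u ω => (T u ω).2) x.2.2 x.1 : ℝ))) =
      marshallOlkin (bernsteinBiv μ z₁ z₂ - bernsteinBiv μ 0 z₂)
        (bernsteinBiv μ z₁ z₂ - bernsteinBiv μ z₁ 0)
        (bernsteinBiv μ z₁ 0 + bernsteinBiv μ 0 z₂ - bernsteinBiv μ z₁ z₂) := by
  have := isProbabilityMeasure_expMeasure hz₁
  have := isProbabilityMeasure_expMeasure hz₂
  have hm := hT.measurable_inversePair
  have hp := sub_nonneg.2 (hT.levyMeasure.bernsteinBiv_mono le_rfl hz₂.le hz₁.le le_rfl)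
  have hq := sub_nonneg.2 (hT.levyMeasure.bernsteinBiv_mono hz₁.le le_rfl le_rfl hz₂.le)
  have hr := sub_nonneg.2 (hT.levyMeasure.bernsteinBiv_le_add hz₁.le hz₂.le)
  have ha : 0 < (bernsteinBiv μ z₁ z₂ - bernsteinBiv μ 0 z₂) +
      (bernsteinBiv μ z₁ 0 + bernsteinBiv μ 0 z₂ - bernsteinBiv μ z₁ z₂) := by
    linarith [hT.levyMeasure.bernsteinBiv_zero_right_pos hμ₁ hz₁]
  have hb : 0 < (bernsteinBiv μ z₁ z₂ - bernsteinBiv μ z₁ 0) +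
      (bernsteinBiv μ z₁ 0 + bernsteinBiv μ 0 z₂ - bernsteinBiv μ z₁ z₂) := by
    linarith [hT.levyMeasure.bernsteinBiv_zero_left_pos hμ₂ hz₂]
  have := isProbabilityMeasure_marshallOlkin hp hq hr ha hb
  have := Measure.isProbabilityMeasure_map (μ := P.prod ((expMeasure z₁).prod (expMeasure z₂)))
    hm.aemeasurable
  have key : ∀ u v : ℝ, 0 ≤ u → 0 ≤ v →
      (P.prod ((expMeasure z₁).prod (expMeasure z₂))).map (fun x : Ω × ℝ × ℝ =>
      ((denseInverse (fun u ω => (T u ω).1) x.2.1 x.1 : ℝ),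
        (denseInverse (fun u ω => (T u ω).2) x.2.2 x.1 : ℝ))) (Ioi u ×ˢ Ioi v) =
      marshallOlkin (bernsteinBiv μ z₁ z₂ - bernsteinBiv μ 0 z₂)
        (bernsteinBiv μ z₁ z₂ - bernsteinBiv μ z₁ 0)
        (bernsteinBiv μ z₁ 0 + bernsteinBiv μ 0 z₂ - bernsteinBiv μ z₁ z₂)
        (Ioi u ×ˢ Ioi v) := by
    intro u v hu hv
    have hQ : MeasurableSet (Ioi u ×ˢ Ioi v) := measurableSet_Ioi.prod measurableSet_Ioi
    have h2 := hT.integral_exp_two_times hz₁.le hz₂.le u.toNNReal v.toNNReal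
    rw [Real.coe_toNNReal u hu, Real.coe_toNNReal v hv] at h2
    rw [marshallOlkin_quadrant hp hq hr ha hb hu hv, ← h2, Measure.map_apply hm hQ,
      Measure.prod_apply (hm hQ), ofReal_integral_eq_lintegral_ofReal
        (hT.integrable_exp hz₁.le hz₂.le _ _) (Eventually.of_forall fun _ => (Real.exp_pos _).le)]
    refine lintegral_congr_ae ?_
    -- With the path of `T` frozen, the only randomness is in the two independent exponential times,
    -- so the section is a rectangle whose mass factors.
    filter_upwards [hT.ae_isSubordinatorPath hμ₁ hμ₂] with ω ⟨g1, g2⟩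
    have hset : Prod.mk ω ⁻¹' ((fun x : Ω × ℝ × ℝ =>
        ((denseInverse (fun u ω => (T u ω).1) x.2.1 x.1 : ℝ),
        (denseInverse (fun u ω => (T u ω).2) x.2.2 x.1 : ℝ))) ⁻¹' (Ioi u ×ˢ Ioi v)) =
        {t | u.toNNReal < rightInverse (fun u ω => (T u ω).1) t ω} ×ˢ
        {t | v.toNNReal < rightInverse (fun u ω => (T u ω).2) t ω} := by
      ext t
      simp only [mem_preimage, mem_prod, mem_Ioi, mem_ofPred_eq,
        IsSubordinatorPath.denseInverse_eq (Y := fun u ω => (T u ω).1) g1,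
        IsSubordinatorPath.denseInverse_eq (Y := fun u ω => (T u ω).2) g2,
        Real.toNNReal_lt_iff_lt_coe hu, Real.toNNReal_lt_iff_lt_coe hv]
    rw [hset, Measure.prod_prod,
      IsSubordinatorPath.expMeasure_lt_rightInverse (Y := fun u ω => (T u ω).1) g1 hz₁,
      IsSubordinatorPath.expMeasure_lt_rightInverse (Y := fun u ω => (T u ω).2) g2 hz₂,
      ← ENNReal.ofReal_mul (Real.exp_pos _).le, ← Real.exp_add]
    congr 2; ring
  refine Measure.ext_of_Ioi_prod_Ioi ?_ key
  rw [key 0 0 le_rfl le_rfl, marshallOlkin_quadrant hp hq hr ha hb le_rfl le_rfl]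
  simp

end IsBivariateSubordinator

/-! ### The double Laplace transform -/

theorem mainTheorem6 {Ω : Type*} [MeasurableSpace Ω] (P : Measure Ω) [IsProbabilityMeasure P]
    (S T : ℝ≥0 → Ω → ℝ × ℝ) (ν μ : Measure (ℝ × ℝ))
    (hS : IsBivariateSubordinator S ν P) (hT : IsBivariateSubordinator T μ P)
    -- neither coordinate of `T` vanishes identically, so that its inverse is finite
    (hμ₁ : marginalLevy₁ μ ≠ 0) (hμ₂ : marginalLevy₂ μ ≠ 0)
    -- the field `(L₁ t₁, L₂ t₂)` is independent of the process `S`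
    (hind : IndepFun (fun ω (t : ℝ≥0 × ℝ≥0) => (inverse₁ T t.1 ω, inverse₂ T t.2 ω))
      (fun ω (u : ℝ≥0) => S u ω) P)
    (z₁ z₂ η₁ η₂ : ℝ) (hz₁ : 0 < z₁) (hz₂ : 0 < z₂) (hη₁ : 0 < η₁) (hη₂ : 0 < η₂) :
    (∀ t₁ t₂ : ℝ, 0 ≤ t₁ → 0 ≤ t₂ → Integrable (fun ω =>
      Real.exp (-η₁ * composition₁ S T t₁ ω - η₂ * composition₂ S T t₂ ω)) P) ∧
    IntegrableOn (fun t : ℝ × ℝ => Real.exp (-z₁ * t.1 - z₂ * t.2) *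
      ∫ ω, Real.exp (-η₁ * composition₁ S T t.1 ω - η₂ * composition₂ S T t.2 ω) ∂P)
      (Ioi 0 ×ˢ Ioi 0) ∧
    (∫ t₁ in Ioi (0 : ℝ), ∫ t₂ in Ioi (0 : ℝ), Real.exp (-z₁ * t₁ - z₂ * t₂) *
      (∫ ω, Real.exp (-η₁ * composition₁ S T t₁ ω - η₂ * composition₂ S T t₂ ω) ∂P)) =
    1 / (z₁ * z₂ * (bernsteinBiv ν η₁ η₂ + bernsteinBiv μ z₁ z₂)) *
      (bernsteinUni (marginalLevy₂ μ) z₂ *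
          (bernsteinBiv μ z₁ z₂ - bernsteinUni (marginalLevy₂ μ) z₂) /
          (bernsteinUni (marginalLevy₂ ν) η₂ + bernsteinUni (marginalLevy₂ μ) z₂) +
        bernsteinUni (marginalLevy₁ μ) z₁ *
          (bernsteinBiv μ z₁ z₂ - bernsteinUni (marginalLevy₁ μ) z₁) /
          (bernsteinUni (marginalLevy₁ ν) η₁ + bernsteinUni (marginalLevy₁ μ) z₁) +
        bernsteinUni (marginalLevy₁ μ) z₁ + bernsteinUni (marginalLevy₂ μ) z₂ -
          bernsteinBiv μ z₁ z₂) := by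
  have := isProbabilityMeasure_expMeasure hz₁
  have := isProbabilityMeasure_expMeasure hz₂
  rw [hT.levyMeasure.bernsteinUni_marginalLevy₁, hT.levyMeasure.bernsteinUni_marginalLevy₂,
    hS.levyMeasure.bernsteinUni_marginalLevy₁, hS.levyMeasure.bernsteinUni_marginalLevy₂]
  set D := fun x : Ω × ℝ × ℝ => ((denseInverse (fun u ω => (T u ω).1) x.2.1 x.1 : ℝ),
    (denseInverse (fun u ω => (T u ω).2) x.2.2 x.1 : ℝ)) with hD
  have hDm : Measurable D := hT.measurable_inversePair
  set p := bernsteinBiv ν η₁ η₂ - bernsteinBiv ν 0 η₂ with hp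
  set q := bernsteinBiv ν η₁ η₂ - bernsteinBiv ν η₁ 0 with hq
  set r := bernsteinBiv ν η₁ 0 + bernsteinBiv ν 0 η₂ - bernsteinBiv ν η₁ η₂ with hr
  have hp0 : 0 ≤ p :=
    sub_nonneg.2 (hS.levyMeasure.bernsteinBiv_mono le_rfl hη₂.le hη₁.le le_rfl)
  have hq0 : 0 ≤ q :=
    sub_nonneg.2 (hS.levyMeasure.bernsteinBiv_mono hη₁.le le_rfl le_rfl hη₂.le)
  have hr0 : 0 ≤ r := sub_nonneg.2 (hS.levyMeasure.bernsteinBiv_le_add hη₁.le hη₂.le)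
  set g := fun x : ℝ × ℝ => Real.exp (-(p * x.1) - q * x.2 - r * max x.1 x.2) with hg
  have hgm : Measurable g := by fun_prop
  have hgb (x : Ω × ℝ × ℝ) : ‖g (D x)‖ ≤ 1 := by
    rw [hg, Real.norm_of_nonneg (Real.exp_pos _).le, Real.exp_le_one_iff]
    have : 0 ≤ p * (D x).1 + q * (D x).2 + r * max (D x).1 (D x).2 := by
      have h1 : 0 ≤ (D x).1 := NNReal.coe_nonneg _
      have h2 : 0 ≤ (D x).2 := NNReal.coe_nonneg _
      positivity
    linarith
  have hpath := hT.ae_isSubordinatorPath hμ₁ hμ₂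
  have hval (t₁ t₂ : ℝ) (h₁ : 0 ≤ t₁) (h₂ : 0 ≤ t₂) : Integrable (fun ω =>
      Real.exp (-η₁ * composition₁ S T t₁ ω - η₂ * composition₂ S T t₂ ω)) P ∧
      ∫ ω, Real.exp (-η₁ * composition₁ S T t₁ ω - η₂ * composition₂ S T t₂ ω) ∂P =
        ∫ ω, g (D (ω, t₁, t₂)) ∂P := by
    -- Independence is assumed for the true inverses; almost sure equality carries it over to their
    -- jointly measurable versions.
    have hpair : (fun ω => (inverse₁ T t₁ ω, inverse₂ T t₂ ω)) =ᵐ[P] fun ω =>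
        (denseInverse (fun u ω => (T u ω).1) t₁ ω, denseInverse (fun u ω => (T u ω).2) t₂ ω) := by
      filter_upwards [hpath] with ω ⟨g1, g2⟩
      rw [IsSubordinatorPath.denseInverse_eq (Y := fun u ω => (T u ω).1) g1,
        IsSubordinatorPath.denseInverse_eq (Y := fun u ω => (T u ω).2) g2]
      rfl
    have hev := hind.comp (measurable_pi_apply (⟨t₁, h₁⟩, ⟨t₂, h₂⟩)) measurable_id
    have hindep := IndepFun.congr hev hpair .rfl
    obtain ⟨i1, i2⟩ := hS.integral_exp_random_times hη₁.le hη₂.le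
      ((measurable_denseInverse fun u => (hT.levy.measurable u).fst).comp measurable_prodMk_left)
      ((measurable_denseInverse fun u => (hT.levy.measurable u).snd).comp measurable_prodMk_left)
      hindep
    have hcomp : (fun ω => Real.exp (-η₁ * (S (denseInverse (fun u ω => (T u ω).1) t₁ ω) ω).1 -
        η₂ * (S (denseInverse (fun u ω => (T u ω).2) t₂ ω) ω).2)) =ᵐ[P]
        fun ω => Real.exp (-η₁ * composition₁ S T t₁ ω - η₂ * composition₂ S T t₂ ω) := by
      filter_upwards [hpair] with ω hω
      rw [Prod.mk.injEq] at hω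
      rw [composition₁, composition₂, hω.1, hω.2]
    exact ⟨i1.congr hcomp, (integral_congr_ae hcomp).symm.trans i2⟩
  have hFm : StronglyMeasurable fun t : ℝ × ℝ => ∫ ω, g (D (ω, t)) ∂P :=
    StronglyMeasurable.integral_prod_right (f := fun t ω => g (D (ω, t)))
      ((hgm.comp hDm).comp measurable_swap).stronglyMeasurable
  have hFb (t : ℝ × ℝ) : ‖∫ ω, g (D (ω, t)) ∂P‖ ≤ 1 := by
    simpa using norm_integral_le_of_norm_le_const (μ := P)
      (Eventually.of_forall fun ω => hgb (ω, t))
  have hQ : MeasurableSet (Ioi (0 : ℝ) ×ˢ Ioi (0 : ℝ)) := measurableSet_Ioi.prod measurableSet_Ioi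
  refine ⟨fun t₁ t₂ h₁ h₂ => (hval t₁ t₂ h₁ h₂).1, ?_, ?_⟩
  · have hexp : IntegrableOn (fun t : ℝ × ℝ => Real.exp (-z₁ * t.1 - z₂ * t.2))
        (Ioi 0 ×ˢ Ioi 0) := by
      have h := (integrableOn_exp_mul_Ioi (neg_lt_zero.2 hz₁) 0).mul_prod
        (integrableOn_exp_mul_Ioi (neg_lt_zero.2 hz₂) 0)
      rw [Measure.prod_restrict] at h
      refine h.congr (Eventually.of_forall fun t => ?_)
      simp only [← Real.exp_add]
      ring_nf
    have h := hexp.mul_bdd (c := 1) hFm.aestronglyMeasurable (Eventually.of_forall hFb)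
    refine h.congr ?_
    filter_upwards [ae_restrict_mem hQ] with t ht
    rw [(hval t.1 t.2 (le_of_lt ht.1) (le_of_lt ht.2)).2]
  · have hint : Integrable (fun t : ℝ × ℝ => ∫ ω, g (D (ω, t)) ∂P)
        ((expMeasure z₁).prod (expMeasure z₂)) :=
      Integrable.of_bound hFm.aestronglyMeasurable 1 (Eventually.of_forall hFb)
    have hint2 : Integrable (fun x => g (D x)) (P.prod ((expMeasure z₁).prod (expMeasure z₂))) :=
      Integrable.of_bound (hgm.comp hDm).aestronglyMeasurable 1 (Eventually.of_forall hgb)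
    have hlaw : ∫ t, (∫ ω, g (D (ω, t)) ∂P) ∂((expMeasure z₁).prod (expMeasure z₂)) =
        ∫ x, g x ∂(marshallOlkin (bernsteinBiv μ z₁ z₂ - bernsteinBiv μ 0 z₂)
        (bernsteinBiv μ z₁ z₂ - bernsteinBiv μ z₁ 0)
        (bernsteinBiv μ z₁ 0 + bernsteinBiv μ 0 z₂ - bernsteinBiv μ z₁ z₂)) := by
      rw [← hT.map_inversePair hμ₁ hμ₂ hz₁ hz₂, integral_map hDm.aemeasurable
        hgm.aestronglyMeasurable, integral_prod_symm _ hint2]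
    have hpos₁ := hT.levyMeasure.bernsteinBiv_zero_right_pos hμ₁ hz₁
    have hpos₂ := hT.levyMeasure.bernsteinBiv_zero_left_pos hμ₂ hz₂
    rw [integral_marshallOlkin
      (sub_nonneg.2 (hT.levyMeasure.bernsteinBiv_mono le_rfl hz₂.le hz₁.le le_rfl))
      (sub_nonneg.2 (hT.levyMeasure.bernsteinBiv_mono hz₁.le le_rfl le_rfl hz₂.le))
      (sub_nonneg.2 (hT.levyMeasure.bernsteinBiv_le_add hz₁.le hz₂.le)) (by linarith)
      (by linarith) hp0 hq0 hr0, integral_prod _ hint, integral_expMeasure hz₁] at hlaw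
    simp_rw [integral_expMeasure hz₂] at hlaw
    -- The exponential densities supply the Laplace kernel and the extra factor `z₁ z₂`.
    have hlhs : ∫ t₁ in Ioi (0 : ℝ), z₁ * Real.exp (-(z₁ * t₁)) *
        ∫ t₂ in Ioi (0 : ℝ), z₂ * Real.exp (-(z₂ * t₂)) * ∫ ω, g (D (ω, t₁, t₂)) ∂P =
        z₁ * z₂ * ∫ t₁ in Ioi (0 : ℝ), ∫ t₂ in Ioi (0 : ℝ), Real.exp (-z₁ * t₁ - z₂ * t₂) *
        ∫ ω, Real.exp (-η₁ * composition₁ S T t₁ ω - η₂ * composition₂ S T t₂ ω) ∂P := by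
      rw [← integral_const_mul]
      refine setIntegral_congr_fun measurableSet_Ioi fun t₁ h₁ => ?_
      change z₁ * Real.exp (-(z₁ * t₁)) * ∫ t₂ in Ioi (0 : ℝ), _ =
        z₁ * z₂ * ∫ t₂ in Ioi (0 : ℝ), _
      rw [← integral_const_mul, ← integral_const_mul]
      refine setIntegral_congr_fun measurableSet_Ioi fun t₂ h₂ => ?_
      have e : Real.exp (-z₁ * t₁ - z₂ * t₂) =
          Real.exp (-(z₁ * t₁)) * Real.exp (-(z₂ * t₂)) := by
        rw [← Real.exp_add]; ring_nf
      simp only [e, (hval t₁ t₂ (le_of_lt h₁) (le_of_lt h₂)).2]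
      ring
    rw [hlhs] at hlaw
    have hz : z₁ * z₂ ≠ 0 := (mul_pos hz₁ hz₂).ne'
    -- For both measures the parameters telescope: `p + q + r`, `p + r` and `q + r` are the
    -- bivariate, first and second marginal exponents.
    rw [← mul_right_inj' hz, hlaw, one_div_mul_eq_div (z₁ * z₂ * _), mul_div_assoc',
      mul_div_mul_left _ _ hz, hp, hq, hr, one_div_mul_eq_div]
    ring_nf
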